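/- Let $n,r\in\mathbb Z_{\ge0}$, let $B=(B^1,\dots,B^r):\mathbb R^{2n}\times\mathbb R^{2n}\to\mathbb R^r$ be a skew-symmetric bilinear mapping, and let $\mathcal N=\mathbb R^{2n}\times\mathbb R^r$ be the nilpotent Lie group of step two with multiplication $(x,t)\cdot(y,s)=(x+y,\,t+s+2B(x,y))$ and Lebesgue measure. For $F,G:\mathcal N\to\mathbb C$ and $\tau\in\mathbb R^r$ put $$F*G(g)=\int_{\mathcal N}F(h)\,G(h^{-1}g)\,dh,\qquad \widetilde F_\tau(y)=\int_{\mathbb R^r}e^{-i\tau\cdot s}F(y,s)\,ds,\qquad B^\tau(x,y)=\sum_{\beta=1}^r\tau_\beta B^\beta(x,y).$$ A *normalizing basis* for $B^\tau$ is an orthonormal basis $v_1,\dots,v_{2n}$ of $\mathbb R^{2n}$, together with numbers $\mu_1,\dots,\mu_n\ge0$, such that $B^\tau(v_{2j},v_{2j-1})=-B^\tau(v_{2j-1},v_{2j})=\mu_j$ for $j=1,\dots,n$ and $B^\tau(v_k,v_l)=0$ for all other pairs $(k,l)$. Given such a basis, write $y=\sum_k y_k^\tau v_k$ and $y^\tau_{2j-1}+iy^\tau_{2j}=\rho_je^{i\theta_j}$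 with $\rho_j\ge0$. With the generalized Laguerre polynomials $L_k^{(a)}$ and $$l_k^{(a)}(\sigma)=\Big[\tfrac{\Gamma(k+1)}{\Gamma(k+a+1)}\Big]^{1/2}L_k^{(a)}(\sigma)\,\sigma^{a/2}e^{-\sigma/2}\qquad(k,a\in\mathbb Z_{\ge0}),$$ put, for $\tau\neq0$, $\mathbf k\in\mathbb Z_{\ge0}^n$, $\mathbf a\in\mathbb Z^n$ and $\dot\mu_j=\mu_j/|\tau|$, $$\widetilde{\mathscr L}^{(\mathbf a)}_{\mathbf k}(y,\tau)=\prod_{j=1}^n\dot\mu_j\,\frac{2|\tau|}{\pi}\,(\operatorname{sgn}a_j)^{a_j}\,l_{k_j}^{(|a_j|)}\big(2|\tau|\dot\mu_j\rho_j^2\big)\,e^{ia_j\theta_j},$$ where $(\operatorname{sgn}0)^0=1$ (for $n=0$ this is the empty product $1$, also at $\tau=0$). For indices $\mathbf p,\mathbf k\in\mathbb Z_+^n$ (positive integers) let $\ell_{\mathbf p,\mathbf k}=\widetilde{\mathscr L}^{(\mathbf p-\mathbf k)}_{\mathbf p\wedge\mathbf k-\mathbf 1}(\cdot,\tau)$,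 where $\mathbf p\wedge\mathbf k-\mathbf 1=(\min(p_j,k_j)-1)_j$. The *Laguerre tensor* of $F$ at $\tau$ is the matrix $\mathcal M_\tau(F)=(F^{\mathbf p}_{\mathbf k}(\tau))_{\mathbf p,\mathbf k\in\mathbb Z_+^n}$, with row index $\mathbf p$ and column index $\mathbf k$, of the coefficients $F^{\mathbf p}_{\mathbf k}(\tau)=\langle\widetilde F_\tau,\ell_{\mathbf p,\mathbf k}\rangle_{L^2}/\|\ell_{\mathbf p,\mathbf k}\|_{L^2}^2$ of $\widetilde F_\tau$ with respect to the functions $\ell_{\mathbf p,\mathbf k}$. **Theorem 1.1.** Suppose that $B^\tau$ is non-degenerate for almost every $\tau\in\mathbb R^r$, and let $F,G\in L^1(\mathcal N)\cap L^2(\mathcal N)$. Then for almost every $\tau\in\mathbb R^r$ a normalizing basis for $B^\tau$ exists and, for every normalizing basis for $B^\tau$: 1. for each $H\in\{F,G,F*G\}$ one has $\widetilde H_\tau\in L^2(\mathbb R^{2n})$, $\sum_{\mathbf p,\mathbf k}|H^{\mathbf p}_{\mathbf k}(\tau)|^2<\infty$, and the Laguerre expansion $\widetilde H_\tau=\sum_{\mathbf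 p,\mathbf k\in\mathbb Z_+^n}H^{\mathbf p}_{\mathbf k}(\tau)\,\ell_{\mathbf p,\mathbf k}$ holds with unconditional convergence in $L^2(\mathbb R^{2n})$; 2. $\mathcal M_\tau(F*G)=\mathcal M_\tau(F)\cdot\mathcal M_\tau(G)$, that is, for all $\mathbf p,\mathbf m\in\mathbb Z_+^n$, $$(F*G)^{\mathbf p}_{\mathbf m}(\tau)=\sum_{\mathbf q\in\mathbb Z_+^n}F^{\mathbf p}_{\mathbf q}(\tau)\,G^{\mathbf q}_{\mathbf m}(\tau),$$ where the series converges absolutely. -/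

import Mathlib

open MeasureTheory Filter Topology
open scoped ComplexConjugate

noncomputable section

/-- A skew-symmetric bilinear mapping `B : ℝ^{2n} × ℝ^{2n} → ℝ^r`, given by the matrices
`(B^β_{kl})`, `β = 1, …, r`. -/
structure SkewMap (n r : ℕ) where
  mat : Fin r → Matrix (Fin (2 * n)) (Fin (2 * n)) ℝ
  skew : ∀ β, (mat β).transpose = -mat β

namespace SkewMap

variable {n r : ℕ} (B : SkewMap n r)

/-- `B(x, y)`, with components `B^β(x, y) = ∑_{k,l} B^β_{kl} x_k y_l`. -/
def map (x y : EuclideanSpace ℝ (Fin (2 * n))) : EuclideanSpace ℝ (Fin r) :=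
  WithLp.toLp 2 fun β => ∑ k, ∑ l, B.mat β k l * x k * y l

/-- The bilinear form `B^τ(x, y) = ∑_β τ_β B^β(x, y)`. -/
def tauForm (τ : EuclideanSpace ℝ (Fin r)) (x y : EuclideanSpace ℝ (Fin (2 * n))) : ℝ :=
  ∑ β, τ β * B.map x y β

/-- The (skew-symmetric) bilinear form `B^τ` is non-degenerate. -/
def TauNondegenerate (τ : EuclideanSpace ℝ (Fin r)) : Prop :=
  ∀ x, (∀ y, B.tauForm τ x y = 0) → x = 0

theorem map_add_left (x x' y : EuclideanSpace ℝ (Fin (2 * n))) :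
    B.map (x + x') y = B.map x y + B.map x' y := by
  ext β
  simp only [map, PiLp.add_apply, ← Finset.sum_add_distrib]
  exact Finset.sum_congr rfl fun k _ => Finset.sum_congr rfl fun l _ => by ring

theorem map_add_right (x y y' : EuclideanSpace ℝ (Fin (2 * n))) :
    B.map x (y + y') = B.map x y + B.map x y' := by
  ext β
  simp only [map, PiLp.add_apply, ← Finset.sum_add_distrib]
  exact Finset.sum_congr rfl fun k _ => Finset.sum_congr rfl fun l _ => by ring

theorem map_neg_left (x y : EuclideanSpace ℝ (Fin (2 * n))) :
    B.map (-x) y = -B.map x y := by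
  ext β
  simp only [map, PiLp.neg_apply, ← Finset.sum_neg_distrib]
  exact Finset.sum_congr rfl fun k _ => Finset.sum_congr rfl fun l _ => by ring

theorem map_swap (x y : EuclideanSpace ℝ (Fin (2 * n))) : B.map y x = -B.map x y := by
  ext β
  simp only [map, PiLp.neg_apply, ← Finset.sum_neg_distrib]
  rw [Finset.sum_comm]
  refine Finset.sum_congr rfl fun k _ => Finset.sum_congr rfl fun l _ => ?_
  have h : B.mat β l k = -B.mat β k l := congrFun (congrFun (B.skew β) k) l
  rw [h]
  ring

theorem map_self (x : EuclideanSpace ℝ (Fin (2 * n))) : B.map x x = 0 := by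
  ext β
  have h : B.map x x β = -B.map x x β := congrArg (fun v => v β) (B.map_swap x x)
  simpa using self_eq_neg.mp h

theorem map_zero_left (y : EuclideanSpace ℝ (Fin (2 * n))) : B.map 0 y = 0 := by
  ext β
  simp [map]

theorem map_zero_right (x : EuclideanSpace ℝ (Fin (2 * n))) : B.map x 0 = 0 := by
  ext β
  simp [map]

end SkewMap

/-- The nilpotent Lie group `𝒩` of step two attached to `B`: the set `ℝ^{2n} × ℝ^r` with the
multiplication `(x,t)·(y,s) = (x + y, t + s + 2 B(x,y))`. -/
def StepTwoGroup {n r : ℕ} (_B : SkewMap n r) : Type :=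
  EuclideanSpace ℝ (Fin (2 * n)) × EuclideanSpace ℝ (Fin r)

namespace StepTwoGroup

variable {n r : ℕ} {B : SkewMap n r}

/-- The measure on `𝒩` is the Lebesgue measure `dy ds` of `ℝ^{2n} × ℝ^r`. -/
instance : MeasureSpace (StepTwoGroup B) :=
  inferInstanceAs (MeasureSpace (EuclideanSpace ℝ (Fin (2 * n)) × EuclideanSpace ℝ (Fin r)))

/-- The element `(x, t)` of the group. -/
def mk (x : EuclideanSpace ℝ (Fin (2 * n))) (t : EuclideanSpace ℝ (Fin r)) : StepTwoGroup B :=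
  (x, t)

instance : Mul (StepTwoGroup B) :=
  ⟨fun g h => mk (g.1 + h.1) (g.2 + h.2 + (2 : ℝ) • B.map g.1 h.1)⟩

instance : One (StepTwoGroup B) := ⟨mk 0 0⟩

instance : Inv (StepTwoGroup B) := ⟨fun g => mk (-g.1) (-g.2)⟩

@[ext] theorem ext {g h : StepTwoGroup B} (h1 : g.1 = h.1) (h2 : g.2 = h.2) : g = h :=
  Prod.ext h1 h2

theorem mul_fst (g h : StepTwoGroup B) : (g * h).1 = g.1 + h.1 := rfl

theorem mul_snd (g h : StepTwoGroup B) :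
    (g * h).2 = g.2 + h.2 + (2 : ℝ) • B.map g.1 h.1 := rfl

theorem one_fst : (1 : StepTwoGroup B).1 = 0 := rfl

theorem one_snd : (1 : StepTwoGroup B).2 = 0 := rfl

theorem inv_fst (g : StepTwoGroup B) : (g⁻¹).1 = -g.1 := rfl

theorem inv_snd (g : StepTwoGroup B) : (g⁻¹).2 = -g.2 := rfl

instance : Group (StepTwoGroup B) where
  mul_assoc a b c := by
    ext1
    · simp only [mul_fst, add_assoc]
    · simp only [mul_snd, mul_fst, SkewMap.map_add_left, SkewMap.map_add_right, smul_add]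
      abel
  one_mul a := by
    ext1
    · simp only [mul_fst, one_fst, zero_add]
    · simp only [mul_snd, one_fst, one_snd, SkewMap.map_zero_left, smul_zero, zero_add, add_zero]
  mul_one a := by
    ext1
    · simp only [mul_fst, one_fst, add_zero]
    · simp only [mul_snd, one_fst, one_snd, SkewMap.map_zero_right, smul_zero, add_zero]
  inv_mul_cancel a := by
    ext1
    · simp only [mul_fst, inv_fst, one_fst, neg_add_cancel]
    · simp only [mul_snd, inv_fst, inv_snd, one_snd, SkewMap.map_neg_left, SkewMap.map_self,
        neg_zero, smul_zero, add_zero, neg_add_cancel]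

/-- The group convolution `(F * G)(g) = ∫_𝒩 F(h) G(h⁻¹ g) dh`. -/
def conv (F G : StepTwoGroup B → ℂ) (g : StepTwoGroup B) : ℂ :=
  ∫ h : StepTwoGroup B, F h * G (h⁻¹ * g)

/-- The partial Fourier transform `F̃_τ(y) = ∫_{ℝ^r} e^{-iτ·s} F(y,s) ds`. -/
def partialFourier (F : StepTwoGroup B → ℂ) (τ : EuclideanSpace ℝ (Fin r))
    (y : EuclideanSpace ℝ (Fin (2 * n))) : ℂ :=
  ∫ s : EuclideanSpace ℝ (Fin r),
    Complex.exp (-(Complex.I * ((inner ℝ τ s : ℝ) : ℂ))) * F (mk y s)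

end StepTwoGroup

/-- An orthonormal basis `v_1, …, v_{2n}` of `ℝ^{2n}` normalizing `B^τ`. The vector `v_{2j-1}` is
`v (j, 0)` and `v_{2j}` is `v (j, 1)`. -/
structure NormalizingBasis {n r : ℕ} (B : SkewMap n r) (τ : EuclideanSpace ℝ (Fin r)) where
  v : OrthonormalBasis (Fin n × Fin 2) ℝ (EuclideanSpace ℝ (Fin (2 * n)))
  /-- the numbers `μ_j(τ)` -/
  mu : Fin n → ℝ
  mu_nonneg : ∀ j, 0 ≤ mu j
  form_fst_snd : ∀ j, B.tauForm τ (v (j, 0)) (v (j, 1)) = -mu j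
  form_snd_fst : ∀ j, B.tauForm τ (v (j, 1)) (v (j, 0)) = mu j
  form_diag : ∀ j a, B.tauForm τ (v (j, a)) (v (j, a)) = 0
  form_off : ∀ j k a b, j ≠ k → B.tauForm τ (v (j, a)) (v (k, b)) = 0

/-- The generalized Laguerre polynomial
`L_k^{(p)}(σ) = ∑_{m=0}^k (-1)^m binom(k+p, k-m) σ^m / m!`. -/
def genLaguerre (k p : ℕ) (σ : ℝ) : ℝ :=
  ∑ m ∈ Finset.range (k + 1), (-1 : ℝ) ^ m * ((k + p).choose (k - m) : ℝ) * σ ^ m / (m.factorial : ℝ)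

/-- The Laguerre function
`l_k^{(p)}(σ) = [Γ(k+1)/Γ(k+p+1)]^{1/2} L_k^{(p)}(σ) σ^{p/2} e^{-σ/2}` on `[0,∞)`. -/
def laguerreFun (k p : ℕ) (σ : ℝ) : ℝ :=
  √((k.factorial : ℝ) / ((k + p).factorial : ℝ)) * genLaguerre k p σ * σ ^ ((p : ℝ) / 2) * Real.exp (-σ / 2)

/-- The exponential Laguerre function on `ℝ² × ℝ^r`,
`(2|τ|/π) (sgn p)^p l_k^{(|p|)}(2|τ||z|²) e^{ipθ}` with `z = y₁ + i y₂ = |z| e^{iθ}`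
(for `p = 0` the sign factor is `1`). -/
def expLaguerrePlane {r : ℕ} (k : ℕ) (p : ℤ) (z : ℂ) (τ : EuclideanSpace ℝ (Fin r)) : ℂ :=
  ((2 * ‖τ‖ / Real.pi * ((p.sign : ℤ) : ℝ) ^ p
      * laguerreFun k p.natAbs (2 * ‖τ‖ * ‖z‖ ^ 2) : ℝ) : ℂ)
    * Complex.exp (Complex.I * (p : ℂ) * (z.arg : ℂ))

namespace NormalizingBasis

variable {n r : ℕ} {B : SkewMap n r} {τ : EuclideanSpace ℝ (Fin r)} (e : NormalizingBasis B τ)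

/-- The `j`-th pair of `τ`-coordinates `(y_{2j-1}^τ, y_{2j}^τ)` of `y`, as the complex number
`y_{2j-1}^τ + i y_{2j}^τ`. -/
def coord (y : EuclideanSpace ℝ (Fin (2 * n))) (j : Fin n) : ℂ :=
  ⟨e.v.repr y (j, 0), e.v.repr y (j, 1)⟩

/-- `μ_j(τ/|τ|) = μ_j(τ)/|τ|`. -/
def muDot (j : Fin n) : ℝ := e.mu j / ‖τ‖

/-- The exponential Laguerre function on `ℝ^{2n}` at `τ`:
`∏_j μ_j(τ/|τ|) · L̃_{k_j}^{(p_j)}(√(μ_j(τ/|τ|)) y_j^τ, τ)`. -/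
def expLaguerre (k : Fin n → ℕ) (p : Fin n → ℤ) (y : EuclideanSpace ℝ (Fin (2 * n))) : ℂ :=
  ∏ j, (e.muDot j : ℂ) * expLaguerrePlane (k j) (p j) ((√(e.muDot j) : ℂ) * e.coord y j) τ

/-- The element of the Laguerre basis with the indices `p, k ∈ ℤ_+^n` (positive integers):
lower index `p ∧ k - 1`, upper index `p - k`. -/
def basisFun (p k : Fin n → ℕ+) : EuclideanSpace ℝ (Fin (2 * n)) → ℂ :=
  e.expLaguerre (fun j => (min (p j) (k j)).natPred) (fun j => ((p j : ℕ) : ℤ) - ((k j : ℕ) : ℤ))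

/-- The coefficient matrix of a function on `ℝ^{2n}` with respect to the orthogonal (not
normalized) Laguerre basis: `⟨f, ℓ_{p,k}⟩ / ‖ℓ_{p,k}‖²`, row index `p`, column index `k`. -/
def coeff (f : EuclideanSpace ℝ (Fin (2 * n)) → ℂ) :
    Matrix (Fin n → ℕ+) (Fin n → ℕ+) ℂ :=
  Matrix.of fun p k =>
    (∫ y, f y * conj (e.basisFun p k y)) / ((∫ y, ‖e.basisFun p k y‖ ^ 2 : ℝ) : ℂ)

/-- `f ∈ L²(ℝ^{2n})` has the Laguerre expansion `f = ∑_{p,k} M_{p,k} ℓ_{p,k}`, unconditionally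
convergent in `L²`, with square summable coefficients. -/
def HasExpansion (f : EuclideanSpace ℝ (Fin (2 * n)) → ℂ)
    (M : Matrix (Fin n → ℕ+) (Fin n → ℕ+) ℂ) : Prop :=
  MemLp f 2 ∧
  Summable (fun i : (Fin n → ℕ+) × (Fin n → ℕ+) => ‖M i.1 i.2‖ ^ 2) ∧
  Tendsto (fun S : Finset ((Fin n → ℕ+) × (Fin n → ℕ+)) =>
      eLpNorm (fun y => f y - ∑ i ∈ S, M i.1 i.2 * e.basisFun i.1 i.2 y) 2)
    atTop (𝓝 0)

/-- The Laguerre tensor `ℳ_τ(F) = (F_k^p(τ))_{p,k}` of a function on the group. -/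
def laguerreTensor (F : StepTwoGroup B → ℂ) : Matrix (Fin n → ℕ+) (Fin n → ℕ+) ℂ :=
  e.coeff (StepTwoGroup.partialFourier F τ)

end NormalizingBasis

end

/-!
The functions `ℓ_{p,k}` are, up to the constant `N = ∏_j 2 μ_j / π` and complex conjugation, the
matrix coefficients of the irreducible representation of `𝒩` with central character `e^{-iτ·t}`.
In the complex coordinates of a normalizing basis, scaled to `w_j = √(2 μ_j) y_j`, they are products
of the functions `D_{p,q}(w)`, the matrix entries of the displacement operators of Bargmann–Fock
space. Up to a Gaussian these entries are polynomials `A_{p,q}(w, -w̄)`, given by a ladder recursion,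
and the recursion gives all that is needed:

* the closed formula with Laguerre polynomials (`ladderPoly_eq_genLaguerre`), which identifies the
  `ℓ_{p,k}` (`NormalizingBasis.basisFun_eq`);
* the addition theorem `∑_q D_{p,q}(w) D_{q,m}(w') = e^{-i Im(w̄ w')} D_{p,m}(w + w')`
  (`hasSum_dispCoeff_mul`), whose phase is the cocycle of the group law; the case `w' = -w` says
  that the matrices `D(w)` have rows and columns of norm one;
* orthogonality (`integral_dispCoeff_mul_conj`), by Gaussian integration by parts;
* a generating function (`hasSum_genTerm`) which for suitable parameters is a Gaussian times a
  Fourier character. Hence a function orthogonal to all `ℓ_{p,k}` vanishes, by injectivity of the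
  Fourier transform on `L¹`.

Thus the `ℓ_{p,k}` form a complete orthogonal system with `‖ℓ_{p,k}‖² = N`, and every `F̃_τ` in `L²`
has its Laguerre expansion. By Plancherel in the central variable and Tonelli, `F̃_τ ∈ L²` for
almost every `τ` whenever `F ∈ L¹ ∩ L²`; this applies to `F * G` too, by Young's inequality.

The coefficients of `F` are `N⁻¹ ∫ F χ_{p,k}` with `χ_{p,k}(x, t) = e^{-iτ·t} conj(ℓ_{p,k}(x))`, and
the addition theorem says `χ_{p,m}(gh) = N⁻¹ ∑_q χ_{p,q}(g) χ_{q,m}(h)`. Integrating this against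
`F(g) G(h)` gives the product formula. Normalizing bases come from the eigenvectors of the square of
the skew-adjoint operator of `B^τ`.
-/

noncomputable section

/-! ### Ladder polynomials and their addition theorem -/

/-- The polynomials `A_{p,q}(v, c) = ∂_a^p ∂_b^q exp(ab + av + bc)` at `a = b = 0`, given by the
recursion `A_{p+1,q} = v A_{p,q} + q A_{p,q-1}`; at `q = 0` the truncated `q - 1` is multiplied
by `0`. For `c = -conj v` they are, up to sign, Itô's complex Hermite polynomials. Keeping `v` and
`c` independent makes the majorant `A_{p,q}(‖v‖, ‖c‖)` and the symmetry in `(v, p) ↔ (c, q)`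
available. -/
def ladderPoly (v c : ℂ) : ℕ → ℕ → ℂ
  | 0, q => c ^ q
  | p + 1, q => v * ladderPoly v c p q + q * ladderPoly v c p (q - 1)

theorem ladderPoly_zero_left (v c : ℂ) (q : ℕ) : ladderPoly v c 0 q = c ^ q := rfl

theorem ladderPoly_succ_left (v c : ℂ) (p q : ℕ) :
    ladderPoly v c (p + 1) q = v * ladderPoly v c p q + q * ladderPoly v c p (q - 1) := rfl

theorem ladderPoly_succ_right (v c : ℂ) (p q : ℕ) :
    ladderPoly v c p (q + 1) = c * ladderPoly v c p q + p * ladderPoly v c (p - 1) q := by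
  induction p generalizing q with
  | zero => simp [ladderPoly_zero_left, pow_succ']
  | succ p ih =>
    rw [ladderPoly_succ_left, ih, ladderPoly_succ_left v c p q]
    rcases p with _ | p
    · rcases q with _ | q
      · simp [ladderPoly_zero_left]; ring
      · simp [ladderPoly_zero_left]; ring
    · rcases q with _ | q
      · simp [ladderPoly_succ_left]; ring
      · have := ih q
        simp only [Nat.add_sub_cancel, ladderPoly_succ_left] at this ⊢
        push_cast at this ⊢
        linear_combination ((q : ℂ) + 1) * this

theorem ladderPoly_zero_right (v c : ℂ) (p : ℕ) : ladderPoly v c p 0 = v ^ p := by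
  induction p with
  | zero => simp [ladderPoly_zero_left]
  | succ p ih => simp [ladderPoly_succ_left, ih, pow_succ']

theorem ladderPoly_swap (v c : ℂ) (p q : ℕ) : ladderPoly v c p q = ladderPoly c v q p := by
  induction p generalizing q with
  | zero => rw [ladderPoly_zero_left, ladderPoly_zero_right]
  | succ p ih => rw [ladderPoly_succ_left, ladderPoly_succ_right, ih, ih]

theorem conj_ladderPoly (v c : ℂ) (p q : ℕ) :
    conj (ladderPoly v c p q) = ladderPoly (conj v) (conj c) p q := by
  induction p generalizing q with
  | zero => simp [ladderPoly_zero_left]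
  | succ p ih => simp [ladderPoly_succ_left, ih]

theorem ladderPoly_eq_sum (v c : ℂ) (p q : ℕ) :
    ladderPoly v c p q = ∑ j ∈ Finset.range (q + 1),
      (q.choose j * p.descFactorial j : ℕ) * v ^ (p - j) * c ^ (q - j) := by
  induction q generalizing p with
  | zero => simp [ladderPoly_zero_right]
  | succ q ih =>
    rw [ladderPoly_succ_right, ih, ih, Finset.mul_sum, Finset.mul_sum,
      Finset.sum_range_succ' (n := q + 1)]
    have h1 : ∀ j ∈ Finset.range (q + 1),
        ((q + 1).choose (j + 1) * p.descFactorial (j + 1) : ℕ) * v ^ (p - (j + 1))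
          * c ^ (q + 1 - (j + 1)) =
        (p : ℂ) * ((q.choose j * (p - 1).descFactorial j : ℕ) * v ^ (p - 1 - j) * c ^ (q - j))
        + (q.choose (j + 1) * p.descFactorial (j + 1) : ℕ) * v ^ (p - (j + 1)) * c ^ (q - j) := by
      intro j _
      have h2 : p.descFactorial (j + 1) = p * (p - 1).descFactorial j := by
        rcases p with _ | p
        · simp
        · rw [Nat.succ_descFactorial_succ, Nat.add_sub_cancel]
      have h3 : p - (j + 1) = p - 1 - j := by omega
      rw [Nat.choose_succ_succ, h2, h3, Nat.add_sub_add_right]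
      push_cast
      ring
    rw [Finset.sum_congr rfl h1, Finset.sum_add_distrib, Finset.sum_range_succ' (n := q)]
    rw [Finset.sum_range_succ (f := fun j => ((q.choose (j + 1) * p.descFactorial (j + 1) : ℕ) : ℂ)
      * v ^ (p - (j + 1)) * c ^ (q - j))]
    have h4 : ∀ j ∈ Finset.range q, ((q.choose (j + 1) * p.descFactorial (j + 1) : ℕ) : ℂ)
        * v ^ (p - (j + 1)) * c ^ (q - j) = c * (((q.choose (j + 1) * p.descFactorial (j + 1) : ℕ) : ℂ)
        * v ^ (p - (j + 1)) * c ^ (q - (j + 1))) := by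
      intro j hj
      have : q - j = q - (j + 1) + 1 := by have := Finset.mem_range.1 hj; omega
      rw [this, pow_succ]
      ring
    rw [Finset.sum_congr rfl h4]
    simp
    ring

/-- Up to a power of `v`, the polynomials `A_{p,q}` are Laguerre polynomials in `-vc`. -/
theorem ladderPoly_eq_genLaguerre (v c : ℂ) (σ : ℝ) (h : v * c = -(σ : ℂ)) (k a : ℕ) :
    ladderPoly v c (k + a) k = v ^ a * k.factorial * (genLaguerre k a σ : ℝ) := by
  rw [ladderPoly_eq_sum, ← Finset.sum_range_reflect, genLaguerre]
  push_cast
  rw [Finset.mul_sum]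
  refine Finset.sum_congr rfl fun m hm => ?_
  have hm : m ≤ k := Nat.lt_succ_iff.1 (Finset.mem_range.1 hm)
  have e2 : k + a - (k - m) = a + m := by omega
  have e3 : k - (k - m) = m := by omega
  rw [e2, e3, pow_add, Nat.descFactorial_eq_factorial_mul_choose]
  have h5 : (k.choose (k - m) : ℂ) * (k - m).factorial * m.factorial = k.factorial := by
    rw [Nat.choose_symm hm, ← Nat.choose_mul_factorial_mul_factorial hm]
    push_cast; ring
  have h6 : v ^ m * c ^ m = (-1) ^ m * (σ : ℂ) ^ m := by
    rw [← mul_pow, h, neg_pow]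
  have h7 : (m.factorial : ℂ) ≠ 0 := by exact_mod_cast m.factorial_ne_zero
  rw [← h5]
  push_cast
  field_simp
  linear_combination ((k.choose (k - m) : ℂ) * (k - m).factorial * (k + a).choose (k - m) * v ^ a) * h6


/-- Index shift in an exponential series: in the pairing `∑ f_q g_q / q!`, multiplication by the
variable is adjoint to differentiation. -/
theorem hasSum_inv_factorial_mul {g : ℕ → ℂ} {a : ℂ}
    (h : HasSum (fun q : ℕ => ((q.factorial : ℂ))⁻¹ * g (q + 1)) a) :
    HasSum (fun q : ℕ => ((q.factorial : ℂ))⁻¹ * (q * g q)) a := by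
  rw [← hasSum_nat_add_iff' 1]
  simp only [Finset.range_one, Finset.sum_singleton, Nat.cast_zero, zero_mul, mul_zero, sub_zero]
  refine h.congr_fun fun q => ?_
  have : (q.factorial : ℂ) ≠ 0 := by exact_mod_cast q.factorial_ne_zero
  have : (q : ℂ) + 1 ≠ 0 := by exact_mod_cast q.succ_ne_zero
  rw [Nat.factorial_succ]
  push_cast
  field_simp

/-- The exponential generating function of `A_{q,m}` in `q`; it is also the case `p = 0` of the
addition theorem. -/
theorem hasSum_pow_mul_ladderPoly (c v' c' : ℂ) (m : ℕ) :
    HasSum (fun q : ℕ => ((q.factorial : ℂ))⁻¹ * (c ^ q * ladderPoly v' c' q m))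
      (Complex.exp (c * v') * (c + c') ^ m) := by
  induction m with
  | zero =>
    have := NormedSpace.expSeries_div_hasSum_exp (c * v')
    rw [← Complex.exp_eq_exp_ℂ] at this
    simp only [pow_zero, mul_one, ladderPoly_zero_right, ← mul_pow]
    simpa only [div_eq_inv_mul] using this
  | succ m ih =>
    have h1 := hasSum_inv_factorial_mul (g := fun q => c ^ q * ladderPoly v' c' (q - 1) m)
      (a := c * (Complex.exp (c * v') * (c + c') ^ m))
      ((ih.mul_left c).congr_fun fun q => by simp; ring)
    convert! (ih.mul_left c').add h1 using 1
    · ext q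
      rw [ladderPoly_succ_right]
      ring
    · ring

/-- The addition theorem: up to the cocycle `exp(c v')`, the infinite matrices `A(v, c)` multiply
like the vectors `(v, c)` add. -/
theorem hasSum_ladderPoly_mul_ladderPoly (v c v' c' : ℂ) (p m : ℕ) :
    HasSum (fun q : ℕ => ((q.factorial : ℂ))⁻¹ * (ladderPoly v c p q * ladderPoly v' c' q m))
      (Complex.exp (c * v') * ladderPoly (v + v') (c + c') p m) := by
  induction p generalizing m with
  | zero => exact hasSum_pow_mul_ladderPoly c v' c' m
  | succ p ih =>
    have h1 := hasSum_inv_factorial_mul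
      (g := fun q => ladderPoly v c p (q - 1) * ladderPoly v' c' q m)
      (a := v' * (Complex.exp (c * v') * ladderPoly (v + v') (c + c') p m)
        + m * (Complex.exp (c * v') * ladderPoly (v + v') (c + c') p (m - 1)))
      ((((ih m).mul_left v').add ((ih (m - 1)).mul_left (m : ℂ))).congr_fun fun q => by
        simp only [Nat.add_sub_cancel, ladderPoly_succ_left]; ring)
    convert! ((ih m).mul_left v).add h1 using 1
    · ext q
      rw [ladderPoly_succ_left]
      ring
    · rw [ladderPoly_succ_left]
      ring

/-! ### Orthogonality with respect to the Gaussian -/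

theorem ladderPoly_neg_neg (v c : ℂ) (p q : ℕ) :
    ladderPoly (-v) (-c) p q = (-1) ^ (p + q) * ladderPoly v c p q := by
  induction p generalizing q with
  | zero => rw [ladderPoly_zero_left, ladderPoly_zero_left, neg_pow, zero_add]
  | succ p ih =>
    rw [ladderPoly_succ_left, ladderPoly_succ_left, ih, ih]
    rcases q with _ | q
    · simp; ring
    · simp; ring

theorem conj_ladderPoly_self (w : ℂ) (p q : ℕ) :
    conj (ladderPoly w (-conj w) p q) = ladderPoly (-w) (-conj (-w)) q p := by
  rw [conj_ladderPoly, ladderPoly_swap]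
  simp

theorem integrable_exp_norm_sub_sq (C b : ℝ) (hb : 0 < b) :
    Integrable fun w : ℂ => Real.exp (C * ‖w‖ - b * ‖w‖ ^ 2) := by
  have h1 : Integrable fun w : ℂ => Real.exp (-(b / 2) * ‖w‖ ^ (2:ℝ)) := by
    have := GaussianFourier.integrable_cexp_neg_mul_sq_norm_add (V := ℂ) (b := (b / 2 : ℝ))
      (by simpa using hb) 0 0
    refine this.norm.congr (ae_of_all _ fun w => ?_)
    simp only [Complex.norm_exp]
    norm_cast
    simp [-Complex.ofReal_div]
  refine (h1.const_mul (Real.exp (C ^ 2 / (2 * b)))).mono' (by fun_prop) (ae_of_all _ fun w => ?_)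
  rw [Real.norm_of_nonneg (Real.exp_pos _).le, ← Real.exp_add, Real.rpow_two]
  refine Real.exp_le_exp.2 ?_
  have : C ^ 2 / (2 * b) + -(b / 2) * ‖w‖ ^ 2 - (C * ‖w‖ - b * ‖w‖ ^ 2)
    = (C - b * ‖w‖) ^ 2 / (2 * b) := by field_simp; ring
  have h2 : 0 ≤ (C - b * ‖w‖) ^ 2 / (2 * b) := by positivity
  linarith

theorem integrable_monomial_mul_gaussian (i j : ℕ) :
    Integrable fun w : ℂ => w ^ i * (-conj w) ^ j * Real.exp (-‖w‖ ^ 2) := by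
  refine ((integrable_exp_norm_sub_sq 1 1 one_pos).const_mul ((i + j).factorial : ℝ)).mono'
    (by fun_prop) (ae_of_all _ fun w => ?_)
  rw [norm_mul, norm_mul, norm_pow, norm_pow, norm_neg, RCLike.norm_conj, ← pow_add,
    Complex.norm_real, Real.norm_of_nonneg (Real.exp_pos _).le, sub_eq_add_neg, Real.exp_add,
    ← mul_assoc]
  have := Real.pow_div_factorial_le_exp ‖w‖ (norm_nonneg w) (i + j)
  have hf : (0:ℝ) < (i + j).factorial := by positivity
  rw [div_le_iff₀ hf] at this
  simp only [one_mul]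
  gcongr
  linarith

theorem integral_monomial_mul_gaussian (i j : ℕ) :
    ∫ w : ℂ, w ^ i * (-conj w) ^ j * Real.exp (-‖w‖ ^ 2)
      = if i = j then (-1) ^ i * (Real.pi * i.factorial : ℂ) else 0 := by
  split_ifs with h
  · subst h
    have h1 := Complex.integral_rpow_mul_exp_neg_rpow (p := 2) (q := 2 * i) one_le_two
      (by have : (0:ℝ) ≤ i := by positivity
          linarith)
    have h2 : ∀ w : ℂ, w ^ i * (-conj w) ^ i * Real.exp (-‖w‖ ^ 2)
        = (-1) ^ i * ((‖w‖ ^ (2 * (i : ℝ)) * Real.exp (-‖w‖ ^ (2:ℝ)) : ℝ) : ℂ) := by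
      intro w
      rw [← mul_pow, mul_neg, Complex.mul_conj, neg_pow, Complex.normSq_eq_norm_sq]
      have : ‖w‖ ^ (2 * (i : ℝ)) = (‖w‖ ^ 2) ^ i := by
        rw [← pow_mul]; exact_mod_cast Real.rpow_natCast ‖w‖ (2 * i)
      rw [this, Real.rpow_two]
      push_cast
      ring
    simp_rw [h2]
    rw [integral_const_mul, integral_complex_ofReal, h1]
    have : (2 * (i:ℝ) + 2) / 2 = i + 1 := by ring
    rw [this, Real.Gamma_nat_eq_factorial]
    push_cast
    ring
  · set I := ∫ w : ℂ, w ^ i * (-conj w) ^ j * Real.exp (-‖w‖ ^ 2) with hI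
    have hij : (i : ℂ) - j ≠ 0 := sub_ne_zero.2 (by exact_mod_cast h)
    -- The rotation by `π / (i - j)` turns the integrand into its negative.
    set u : Circle := Circle.exp (Real.pi / ((i : ℝ) - j)) with hu
    have h1 := (rotation u).measurePreserving.integral_comp
      (rotation u).toHomeomorph.measurableEmbedding
      (fun w : ℂ => w ^ i * (-conj w) ^ j * Real.exp (-‖w‖ ^ 2))
    have h2 : (u : ℂ) ^ i * (conj (u : ℂ)) ^ j = -1 := by
      rw [hu, Circle.coe_exp, ← Complex.exp_conj, ← Complex.exp_nat_mul, ← Complex.exp_nat_mul,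
        ← Complex.exp_add, ← Complex.exp_pi_mul_I]
      congr 1
      simp
      field_simp
      ring
    have h3 : ∀ w : ℂ, (rotation u w) ^ i * (-conj (rotation u w)) ^ j
        * (Real.exp (-‖rotation u w‖ ^ 2) : ℂ)
        = -(w ^ i * (-conj w) ^ j * Real.exp (-‖w‖ ^ 2)) := by
      intro w
      rw [LinearIsometryEquiv.norm_map, rotation_apply, map_mul, ← mul_neg, mul_pow, mul_pow]
      linear_combination (w ^ i * (-conj w) ^ j * (Real.exp (-‖w‖ ^ 2) : ℂ)) * h2
    simp_rw [h3] at h1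
    rw [integral_neg, ← hI] at h1
    exact self_eq_neg.1 h1.symm

/-- The integral `∫ w^i A_{p',q'}(w, -w̄) A_{p,q}(w, -w̄) e^{-|w|²} dw`. The factor `w^i` is what the
induction on `p'` in `gaussianPairing_lower` produces. -/
def gaussianPairing (i p' q' p q : ℕ) : ℂ :=
  ∫ w : ℂ, w ^ i * ladderPoly w (-conj w) p' q' * ladderPoly w (-conj w) p q
    * Real.exp (-‖w‖ ^ 2)

theorem integrable_ladderPoly_mul_gaussian (i j p q : ℕ) :
    Integrable fun w : ℂ => w ^ i * (-conj w) ^ j * ladderPoly w (-conj w) p q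
      * Real.exp (-‖w‖ ^ 2) := by
  induction p generalizing i q with
  | zero =>
    refine (integrable_monomial_mul_gaussian i (j + q)).congr (ae_of_all _ fun w => ?_)
    simp only [ladderPoly_zero_left]; ring
  | succ p ih =>
    refine ((ih (i + 1) q).add ((ih i (q - 1)).const_mul (q : ℂ))).congr (ae_of_all _ fun w => ?_)
    simp only [ladderPoly_succ_left, Pi.add_apply]; ring

theorem integrable_ladderPoly_mul_ladderPoly_mul_gaussian (i p' q' p q : ℕ) :
    Integrable fun w : ℂ => w ^ i * ladderPoly w (-conj w) p' q' * ladderPoly w (-conj w) p q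
      * Real.exp (-‖w‖ ^ 2) := by
  induction p' generalizing i q' with
  | zero => exact integrable_ladderPoly_mul_gaussian i q' p q
  | succ p' ih =>
    refine ((ih (i + 1) q').add ((ih i (q' - 1)).const_mul (q' : ℂ))).congr
      (ae_of_all _ fun w => ?_)
    simp only [ladderPoly_succ_left, Pi.add_apply]; ring

theorem gaussianPairing_succ_left (i p' q' p q : ℕ) :
    gaussianPairing i (p' + 1) q' p q
      = gaussianPairing (i + 1) p' q' p q + q' * gaussianPairing i p' (q' - 1) p q := by
  simp only [gaussianPairing]
  rw [← integral_const_mul, ← integral_add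
    (integrable_ladderPoly_mul_ladderPoly_mul_gaussian _ _ _ _ _)
    ((integrable_ladderPoly_mul_ladderPoly_mul_gaussian _ _ _ _ _).const_mul _)]
  refine integral_congr_ae (ae_of_all _ fun w => ?_)
  simp only [ladderPoly_succ_left]; ring

theorem gaussianPairing_succ_right (i p' q' p q : ℕ) :
    gaussianPairing i p' q' (p + 1) q
      = gaussianPairing (i + 1) p' q' p q + q * gaussianPairing i p' q' p (q - 1) := by
  simp only [gaussianPairing]
  rw [← integral_const_mul, ← integral_add
    (integrable_ladderPoly_mul_ladderPoly_mul_gaussian _ _ _ _ _)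
    ((integrable_ladderPoly_mul_ladderPoly_mul_gaussian _ _ _ _ _).const_mul _)]
  refine integral_congr_ae (ae_of_all _ fun w => ?_)
  simp only [ladderPoly_succ_left]; ring

theorem gaussianPairing_zero_zero (i q' q : ℕ) :
    gaussianPairing i 0 q' 0 q
      = if i = q' + q then (-1) ^ i * (Real.pi * i.factorial : ℂ) else 0 := by
  rw [← integral_monomial_mul_gaussian]
  simp only [gaussianPairing, ladderPoly_zero_left]
  refine integral_congr_ae (ae_of_all _ fun w => ?_)
  simp only []; ring

/-- Integration by parts against the Gaussian, `∫ w φ e^{-|w|²} = ∫ (∂φ/∂w̄) e^{-|w|²}`, for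
`φ = w^i (-w̄)^{q'} A_{p,q}`. It is read off from the moments of the Gaussian. -/
theorem gaussianPairing_ibp_zero (i q' p q : ℕ) :
    gaussianPairing (i + 1) 0 q' p q
      = -(q' * gaussianPairing i 0 (q' - 1) p q) - q * gaussianPairing i 0 q' p (q - 1) := by
  induction p generalizing i q with
  | zero =>
    simp only [gaussianPairing_zero_zero]
    rcases q' with _ | q' <;> rcases q with _ | q
    · simp
    · simp only [zero_add, Nat.add_right_cancel_iff, Nat.add_sub_cancel, Nat.cast_zero, zero_mul,
        neg_zero, zero_sub]
      split_ifs with h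
      · subst h; rw [Nat.factorial_succ]; push_cast; ring
      · simp
    · simp only [add_zero, Nat.add_right_cancel_iff, Nat.add_sub_cancel, Nat.cast_zero, zero_mul,
        sub_zero]
      split_ifs with h
      · subst h; rw [Nat.factorial_succ]; push_cast; ring
      · simp
    · have e1 : i + 1 = q' + 1 + (q + 1) ↔ i = q' + (q + 1) := by omega
      have e2 : i = q' + 1 + q ↔ i = q' + (q + 1) := by omega
      simp only [Nat.add_sub_cancel, e1, e2]
      split_ifs with h
      · subst h; rw [Nat.factorial_succ]; push_cast; ring
      · simp
  | succ p ih =>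
    simp only [gaussianPairing_succ_right, ih]
    ring

/-- Under the Gaussian pairing, raising the index `p` on one factor lowers the index `q'` of the
other factor. -/
theorem gaussianPairing_lower (i p' q' p q : ℕ) :
    gaussianPairing i p' q' (p + 1) q = -(q' * gaussianPairing i p' (q' - 1) p q) := by
  induction p' generalizing i q' with
  | zero =>
    rw [gaussianPairing_succ_right, gaussianPairing_ibp_zero]
    ring
  | succ p' ih =>
    simp only [gaussianPairing_succ_left, ih]
    ring

theorem gaussianPairing_comm (p' q' p q : ℕ) :
    gaussianPairing 0 p' q' p q = gaussianPairing 0 p q p' q' := by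
  simp only [gaussianPairing]
  refine integral_congr_ae (ae_of_all _ fun w => ?_)
  simp only []; ring

theorem gaussianPairing_swap (p' q' p q : ℕ) :
    gaussianPairing 0 p' q' p q = gaussianPairing 0 q' p' q p := by
  simp only [gaussianPairing]
  let R : ℂ ≃ₗᵢ[ℝ] ℂ := Complex.conjLIE.trans (LinearIsometryEquiv.neg ℝ)
  rw [← R.measurePreserving.integral_comp R.toHomeomorph.measurableEmbedding]
  refine integral_congr_ae (ae_of_all _ fun w => ?_)
  have hR : R w = -conj w := rfl
  simp only [LinearIsometryEquiv.norm_map]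
  rw [hR, map_neg, Complex.conj_conj, neg_neg, ladderPoly_swap, ladderPoly_swap _ _ p q]
  simp

theorem gaussianPairing_eq (p' q' p q : ℕ) :
    gaussianPairing 0 p' q' p q
      = if p = q' ∧ q = p' then (-1) ^ (p + q) * (Real.pi * p.factorial * q.factorial : ℂ)
        else 0 := by
  induction p generalizing q' with
  | zero =>
    induction q generalizing p' with
    | zero =>
      rcases p' with _ | p'
      · rcases q' with _ | q'
        · simp [gaussianPairing_zero_zero]
        · rw [gaussianPairing_comm, gaussianPairing_swap, gaussianPairing_lower]
          simp
      · rw [gaussianPairing_comm, gaussianPairing_lower]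
        simp
    | succ q ih =>
      rw [gaussianPairing_swap, gaussianPairing_lower, gaussianPairing_swap]
      rcases p' with _ | p'
      · simp
      · rw [Nat.add_sub_cancel, ih]
        simp only [Nat.add_right_cancel_iff]
        split_ifs with h
        · obtain ⟨rfl, rfl⟩ := h
          rw [Nat.factorial_succ]; push_cast; ring
        · simp
  | succ p ih =>
    rw [gaussianPairing_lower]
    rcases q' with _ | q'
    · simp
    · rw [Nat.add_sub_cancel, ih]
      simp only [Nat.add_right_cancel_iff]
      split_ifs with h
      · obtain ⟨rfl, rfl⟩ := h
        rw [Nat.factorial_succ]; push_cast; ring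
      · simp

/-! ### Matrix coefficients of displacement operators -/

/-- The coefficient `D_{p,q}(w)` of the Bargmann–Fock (displacement) operator with parameter `w` in
the orthonormal basis `z^p / √p!`. These functions are, up to a constant and a dilation, the
exponential Laguerre functions in one complex variable (`expLaguerrePlane_eq_dispCoeff`). -/
def dispCoeff (p q : ℕ) (w : ℂ) : ℂ :=
  ((√(p.factorial : ℝ))⁻¹ * (√(q.factorial : ℝ))⁻¹ * Real.exp (-‖w‖ ^ 2 / 2) : ℝ)
    * ladderPoly w (-conj w) p q

theorem inv_sqrt_factorial_mul_self (q : ℕ) :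
    (((√(q.factorial : ℝ))⁻¹ : ℝ) : ℂ) * (((√(q.factorial : ℝ))⁻¹ : ℝ) : ℂ)
      = ((q.factorial : ℂ))⁻¹ := by
  rw [← Complex.ofReal_mul, ← mul_inv, Real.mul_self_sqrt (by positivity)]
  push_cast; rfl

theorem continuous_ladderPoly (p q : ℕ) :
    Continuous fun w : ℂ => ladderPoly w (-conj w) p q := by
  induction p generalizing q with
  | zero => simp only [ladderPoly_zero_left]; fun_prop
  | succ p ih =>
    simp only [ladderPoly_succ_left]
    exact (continuous_id.mul (ih q)).add (continuous_const.mul (ih (q - 1)))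

theorem continuous_dispCoeff (p q : ℕ) : Continuous (dispCoeff p q) := by
  unfold dispCoeff
  exact (by fun_prop : Continuous fun w : ℂ => (((√(p.factorial : ℝ))⁻¹ * (√(q.factorial : ℝ))⁻¹
    * Real.exp (-‖w‖ ^ 2 / 2) : ℝ) : ℂ)).mul (continuous_ladderPoly p q)

theorem conj_dispCoeff (p q : ℕ) (w : ℂ) : conj (dispCoeff p q w) = dispCoeff q p (-w) := by
  rw [dispCoeff, dispCoeff, map_mul, conj_ladderPoly_self, Complex.conj_ofReal, norm_neg]
  push_cast; ring

theorem dispCoeff_zero_self (p : ℕ) : dispCoeff p p 0 = 1 := by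
  have h : ∀ p : ℕ, ladderPoly 0 0 p p = p.factorial := by
    intro p
    induction p with
    | zero => simp [ladderPoly_zero_left]
    | succ p ih => simp [ladderPoly_succ_left, ih, Nat.factorial_succ]
  have h2 : ((p.factorial : ℕ) : ℂ) ≠ 0 := by exact_mod_cast p.factorial_ne_zero
  have := inv_sqrt_factorial_mul_self p
  simp only [dispCoeff, map_zero, neg_zero, h]
  push_cast at this ⊢
  rw [this]
  simp [h2]

/-- The displacement operators compose up to the phase `exp(-i Im(w̄ w'))`. -/
theorem hasSum_dispCoeff_mul (w w' : ℂ) (p m : ℕ) :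
    HasSum (fun q => dispCoeff p q w * dispCoeff q m w')
      (Complex.exp (-(Complex.I * (conj w * w').im)) * dispCoeff p m (w + w')) := by
  have h := (hasSum_ladderPoly_mul_ladderPoly w (-conj w) w' (-conj w') p m).mul_left
    ((((√(p.factorial : ℝ))⁻¹ * (√(m.factorial : ℝ))⁻¹ * Real.exp (-‖w‖ ^ 2 / 2)
      * Real.exp (-‖w'‖ ^ 2 / 2) : ℝ) : ℂ))
  convert! h using 1
  · ext q
    rw [← inv_sqrt_factorial_mul_self q, dispCoeff, dispCoeff]
    push_cast; ring
  · rw [dispCoeff, map_add, neg_add]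
    -- The cocycle `exp(-w̄ w')` splits into a Gaussian factor and a phase.
    have h2 : Complex.exp (-(Complex.I * (conj w * w').im)) * (Real.exp (-‖w + w'‖ ^ 2 / 2) : ℝ)
        = (Real.exp (-‖w‖ ^ 2 / 2) : ℝ) * (Real.exp (-‖w'‖ ^ 2 / 2) : ℝ)
          * Complex.exp (-conj w * w') := by
      rw [Complex.ofReal_exp, Complex.ofReal_exp, Complex.ofReal_exp, ← Complex.exp_add,
        ← Complex.exp_add, ← Complex.exp_add]
      congr 1
      rw [← Complex.normSq_eq_norm_sq, ← Complex.normSq_eq_norm_sq, ← Complex.normSq_eq_norm_sq]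
      apply Complex.ext
      · simp [Complex.normSq_apply]; ring
      · simp [Complex.normSq_apply]
    push_cast at h2 ⊢
    linear_combination ((√(p.factorial : ℝ) : ℂ)⁻¹ * (√(m.factorial : ℝ) : ℂ)⁻¹
      * ladderPoly (w + w') (-conj w + -conj w') p m) * h2

/-- The rows of the matrix `D(w)` are unit vectors: take `w' = -w` in the composition law, where
`D(-w)` is the adjoint of `D(w)`. -/
theorem hasSum_norm_dispCoeff_sq (p : ℕ) (w : ℂ) : HasSum (fun q => ‖dispCoeff p q w‖ ^ 2) 1 := by
  have h := hasSum_dispCoeff_mul w (-w) p p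
  rw [add_neg_cancel, dispCoeff_zero_self, mul_neg, ← Complex.normSq_eq_conj_mul_self] at h
  simp only [← conj_dispCoeff, Complex.mul_conj, Complex.normSq_eq_norm_sq] at h
  rw [← Complex.ofReal_neg, Complex.ofReal_im, Complex.ofReal_zero, mul_zero, neg_zero,
    Complex.exp_zero, one_mul, ← Complex.ofReal_one] at h
  exact Complex.hasSum_ofReal.1 h

theorem norm_dispCoeff_swap (p q : ℕ) (w : ℂ) : ‖dispCoeff p q w‖ = ‖dispCoeff q p (-w)‖ := by
  rw [← conj_dispCoeff, RCLike.norm_conj]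

theorem hasSum_norm_dispCoeff_sq' (m : ℕ) (w : ℂ) :
    HasSum (fun q => ‖dispCoeff q m w‖ ^ 2) 1 := by
  simpa only [norm_dispCoeff_swap _ m w] using hasSum_norm_dispCoeff_sq m (-w)

theorem norm_dispCoeff_le_one (p q : ℕ) (w : ℂ) : ‖dispCoeff p q w‖ ≤ 1 := by
  have := le_hasSum (hasSum_norm_dispCoeff_sq p w) q fun _ _ => by positivity
  exact (sq_le_one_iff₀ (norm_nonneg _)).1 this

theorem summable_norm_dispCoeff_mul (w w' : ℂ) (p m : ℕ) :
    Summable fun q => ‖dispCoeff p q w * dispCoeff q m w'‖ := by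
  have h := ((hasSum_norm_dispCoeff_sq p w).add (hasSum_norm_dispCoeff_sq' m w')).div_const 2
  refine Summable.of_nonneg_of_le (fun q => norm_nonneg _) (fun q => ?_) h.summable
  rw [norm_mul]
  have := two_mul_le_add_sq ‖dispCoeff p q w‖ ‖dispCoeff q m w'‖
  linarith

/-- Orthogonality of the `D_{p,q}` in `L²(ℂ)`. -/
theorem integral_dispCoeff_mul_conj (p q p' q' : ℕ) :
    ∫ w : ℂ, dispCoeff p q w * conj (dispCoeff p' q' w)
      = if p = p' ∧ q = q' then (Real.pi : ℂ) else 0 := by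
  have h : ∀ w : ℂ, dispCoeff p q w * conj (dispCoeff p' q' w)
      = (((√(p.factorial : ℝ))⁻¹ * (√(q.factorial : ℝ))⁻¹ * (√(p'.factorial : ℝ))⁻¹
          * (√(q'.factorial : ℝ))⁻¹ : ℝ) : ℂ) * (-1) ^ (p' + q')
        * (w ^ 0 * ladderPoly w (-conj w) q' p' * ladderPoly w (-conj w) p q
          * Real.exp (-‖w‖ ^ 2)) := by
    intro w
    rw [dispCoeff, dispCoeff, map_mul, conj_ladderPoly_self, map_neg, ladderPoly_neg_neg,
      Complex.conj_ofReal]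
    have : Real.exp (-‖w‖ ^ 2) = Real.exp (-‖w‖ ^ 2 / 2) * Real.exp (-‖w‖ ^ 2 / 2) := by
      rw [← Real.exp_add]; ring_nf
    rw [this]
    push_cast; ring
  simp_rw [h]
  rw [integral_const_mul]
  change _ * gaussianPairing 0 q' p' p q = _
  rw [gaussianPairing_eq]
  split_ifs with hpq
  · obtain ⟨rfl, rfl⟩ := hpq
    have h1 := inv_sqrt_factorial_mul_self p
    have h2 := inv_sqrt_factorial_mul_self q
    have h3 : (p.factorial : ℂ) ≠ 0 := by exact_mod_cast p.factorial_ne_zero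
    have h4 : (q.factorial : ℂ) ≠ 0 := by exact_mod_cast q.factorial_ne_zero
    have h5 : ((-1 : ℂ) ^ (p + q)) * (-1) ^ (p + q) = 1 := by
      rw [← mul_pow]; simp
    push_cast at h1 h2 ⊢
    calc _ = ((√(p.factorial : ℝ) : ℂ)⁻¹ * (√(p.factorial : ℝ) : ℂ)⁻¹)
          * ((√(q.factorial : ℝ) : ℂ)⁻¹ * (√(q.factorial : ℝ) : ℂ)⁻¹)
          * (((-1 : ℂ) ^ (p + q)) * (-1) ^ (p + q))
          * (Real.pi * p.factorial * q.factorial) := by ring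
      _ = _ := by rw [h1, h2, h5]; field_simp
  · simp

/-! ### The generating function -/

theorem hasSum_ladderPoly_generating (v c b : ℂ) (p : ℕ) :
    HasSum (fun q : ℕ => ((q.factorial : ℂ))⁻¹ * (b ^ q * ladderPoly v c p q))
      (Complex.exp (b * c) * (b + v) ^ p) := by
  simpa only [ladderPoly_swap c v] using hasSum_pow_mul_ladderPoly b c v p

theorem exists_ladderPoly_ofReal {s t : ℝ} (hs : 0 ≤ s) (ht : 0 ≤ t) (p q : ℕ) :
    ∃ M : ℝ, 0 ≤ M ∧ ladderPoly s t p q = M := by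
  induction p generalizing q with
  | zero => exact ⟨t ^ q, by positivity, by simp [ladderPoly_zero_left]⟩
  | succ p ih =>
    obtain ⟨M, hM, h⟩ := ih q
    obtain ⟨M', hM', h'⟩ := ih (q - 1)
    exact ⟨s * M + q * M', by positivity, by rw [ladderPoly_succ_left, h, h']; push_cast; rfl⟩

theorem norm_ladderPoly_le (v c : ℂ) (p q : ℕ) :
    ‖ladderPoly v c p q‖ ≤ ‖ladderPoly (‖v‖ : ℂ) (‖c‖ : ℂ) p q‖ := by
  induction p generalizing q with
  | zero => simp [ladderPoly_zero_left]
  | succ p ih =>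
    obtain ⟨M, hM, h⟩ := exists_ladderPoly_ofReal (norm_nonneg v) (norm_nonneg c) p q
    obtain ⟨M', hM', h'⟩ := exists_ladderPoly_ofReal (norm_nonneg v) (norm_nonneg c) p (q - 1)
    have i1 := ih q
    have i2 := ih (q - 1)
    rw [ladderPoly_succ_left, ladderPoly_succ_left]
    rw [h] at i1 ⊢
    rw [h'] at i2 ⊢
    rw [Complex.norm_real, Real.norm_of_nonneg hM] at i1
    rw [Complex.norm_real, Real.norm_of_nonneg hM'] at i2
    have : ‖((‖v‖ : ℝ) : ℂ) * (M : ℂ) + (q : ℂ) * (M' : ℂ)‖ = ‖v‖ * M + q * M' := by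
      have : ((‖v‖ : ℝ) : ℂ) * (M : ℂ) + (q : ℂ) * (M' : ℂ) = ((‖v‖ * M + q * M' : ℝ) : ℂ) := by
        push_cast; rfl
      rw [this, Complex.norm_real, Real.norm_of_nonneg (by positivity)]
    rw [this]
    refine (norm_add_le _ _).trans ?_
    rw [norm_mul, norm_mul, Complex.norm_natCast]
    gcongr

/-- The terms `a^p b^q D_{p,q}(w) / √(p! q!)` of the generating function of the `D_{p,q}`. -/
def genTerm (a b w : ℂ) (x : ℕ × ℕ) : ℂ :=
  (((√(x.1.factorial : ℝ))⁻¹ : ℝ) : ℂ) * (((√(x.2.factorial : ℝ))⁻¹ : ℝ) : ℂ)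
    * (a ^ x.1 * b ^ x.2) * dispCoeff x.1 x.2 w

/-- A majorant of `genTerm`, obtained by replacing all variables by their absolute values. Its sum
(`hasSum_genMajorant`) still decays like a Gaussian in `w`. -/
def genMajorant (a b w : ℂ) (x : ℕ × ℕ) : ℝ :=
  ((x.1.factorial : ℝ))⁻¹ * ((x.2.factorial : ℝ))⁻¹ * (‖a‖ ^ x.1 * ‖b‖ ^ x.2)
    * Real.exp (-‖w‖ ^ 2 / 2) * ‖ladderPoly (‖w‖ : ℂ) (‖w‖ : ℂ) x.1 x.2‖

theorem genTerm_eq (a b w : ℂ) (x : ℕ × ℕ) :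
    genTerm a b w x = Real.exp (-‖w‖ ^ 2 / 2) * (((x.1.factorial : ℂ))⁻¹ * (a ^ x.1
      * (((x.2.factorial : ℂ))⁻¹ * (b ^ x.2 * ladderPoly w (-conj w) x.1 x.2)))) := by
  rw [genTerm, dispCoeff, ← inv_sqrt_factorial_mul_self, ← inv_sqrt_factorial_mul_self]
  push_cast; ring

theorem norm_genTerm_le (a b w : ℂ) (x : ℕ × ℕ) : ‖genTerm a b w x‖ ≤ genMajorant a b w x := by
  have h := norm_ladderPoly_le w (-conj w) x.1 x.2
  rw [norm_neg, RCLike.norm_conj] at h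
  rw [genTerm_eq, genMajorant]
  simp only [norm_mul, norm_inv, norm_pow, Complex.norm_natCast, Complex.norm_real,
    Real.norm_of_nonneg (Real.exp_pos _).le]
  calc _ = ((x.1.factorial : ℝ))⁻¹ * ((x.2.factorial : ℝ))⁻¹ * (‖a‖ ^ x.1 * ‖b‖ ^ x.2)
    * Real.exp (-‖w‖ ^ 2 / 2) * ‖ladderPoly w (-conj w) x.1 x.2‖ := by ring
    _ ≤ _ := by gcongr

theorem hasSum_genMajorant (a b w : ℂ) :
    HasSum (genMajorant a b w)
      (Real.exp (‖a‖ * ‖b‖ + (‖a‖ + ‖b‖) * ‖w‖ - ‖w‖ ^ 2 / 2)) := by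
  have hM : ∀ p q, ((‖ladderPoly (‖w‖ : ℂ) (‖w‖ : ℂ) p q‖ : ℝ) : ℂ)
      = ladderPoly (‖w‖ : ℂ) (‖w‖ : ℂ) p q := by
    intro p q
    obtain ⟨M, hM, h⟩ := exists_ladderPoly_ofReal (norm_nonneg w) (norm_nonneg w) p q
    rw [h, Complex.norm_real, Real.norm_of_nonneg hM]
  have h1 : ∀ p, HasSum (fun q => genMajorant a b w (p, q)) (Real.exp (-‖w‖ ^ 2 / 2) *
      (((p.factorial : ℝ))⁻¹ * ‖a‖ ^ p * (Real.exp (‖b‖ * ‖w‖) * (‖b‖ + ‖w‖) ^ p))) := by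
    intro p
    rw [← Complex.hasSum_ofReal]
    convert! (hasSum_ladderPoly_generating (‖w‖ : ℂ) ‖w‖ ‖b‖ p).mul_left
      ((Real.exp (-‖w‖ ^ 2 / 2) : ℂ) * (((p.factorial : ℂ))⁻¹ * (‖a‖ : ℂ) ^ p)) using 1
    · ext q
      simp only [genMajorant, Complex.ofReal_mul, hM]
      push_cast; ring
    · push_cast; ring
  have h2 : HasSum (fun p : ℕ => Real.exp (-‖w‖ ^ 2 / 2) *
      (((p.factorial : ℝ))⁻¹ * ‖a‖ ^ p * (Real.exp (‖b‖ * ‖w‖) * (‖b‖ + ‖w‖) ^ p)))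
      (Real.exp (‖a‖ * ‖b‖ + (‖a‖ + ‖b‖) * ‖w‖ - ‖w‖ ^ 2 / 2)) := by
    have := NormedSpace.expSeries_div_hasSum_exp (‖a‖ * (‖b‖ + ‖w‖))
    rw [← Real.exp_eq_exp_ℝ] at this
    convert! this.mul_left (Real.exp (-‖w‖ ^ 2 / 2) * Real.exp (‖b‖ * ‖w‖)) using 1
    · ext p; rw [mul_pow]; ring
    · rw [← Real.exp_add, ← Real.exp_add]; ring_nf
  have hnn : ∀ x, 0 ≤ genMajorant a b w x := fun x => by unfold genMajorant; positivity
  have hs : Summable (genMajorant a b w) := by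
    rw [summable_prod_of_nonneg hnn]
    exact ⟨fun p => (h1 p).summable, by simpa only [(h1 _).tsum_eq] using h2.summable⟩
  rw [← (hs.hasSum.prod_fiberwise h1).unique h2]
  exact hs.hasSum

theorem hasSum_genTerm (a b w : ℂ) :
    HasSum (genTerm a b w) (Complex.exp (a * b + a * w - b * conj w - ‖w‖ ^ 2 / 2)) := by
  have h1 : ∀ p, HasSum (fun q => genTerm a b w (p, q)) (Real.exp (-‖w‖ ^ 2 / 2) *
      (((p.factorial : ℂ))⁻¹ * (a ^ p * (Complex.exp (b * -conj w) * (b + w) ^ p)))) := by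
    intro p
    simp only [genTerm_eq]
    exact (((hasSum_ladderPoly_generating w (-conj w) b p).mul_left _).mul_left _).mul_left _
  have h2 : HasSum (fun p : ℕ => (Real.exp (-‖w‖ ^ 2 / 2) : ℂ) *
      (((p.factorial : ℂ))⁻¹ * (a ^ p * (Complex.exp (b * -conj w) * (b + w) ^ p))))
      (Complex.exp (a * b + a * w - b * conj w - ‖w‖ ^ 2 / 2)) := by
    have := NormedSpace.expSeries_div_hasSum_exp (a * (b + w))
    rw [← Complex.exp_eq_exp_ℂ] at this
    convert! this.mul_left ((Real.exp (-‖w‖ ^ 2 / 2) : ℂ) * Complex.exp (b * -conj w)) using 1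
    · ext p; rw [mul_pow]; ring
    · rw [Complex.ofReal_exp, ← Complex.exp_add, ← Complex.exp_add]; push_cast; ring_nf
  have hs : Summable (genTerm a b w) :=
    Summable.of_norm_bounded (hasSum_genMajorant a b w).summable (norm_genTerm_le a b w)
  rw [← (hs.hasSum.prod_fiberwise h1).unique h2]
  exact hs.hasSum

/-! ### Comparison with the exponential Laguerre functions -/

theorem dispCoeff_add_left (q a : ℕ) (w : ℂ) :
    dispCoeff (q + a) q w = (laguerreFun q a (‖w‖ ^ 2) : ℝ) * Complex.exp (Complex.I * a * w.arg) := by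
  have h : w * -conj w = -((‖w‖ ^ 2 : ℝ) : ℂ) := by
    rw [mul_neg, Complex.mul_conj, Complex.normSq_eq_norm_sq]
  rw [dispCoeff, ladderPoly_eq_genLaguerre _ _ _ h, laguerreFun]
  have h1 : (‖w‖ ^ 2) ^ ((a : ℝ) / 2) = ‖w‖ ^ a := by
    rw [← Real.rpow_natCast_mul (norm_nonneg w)]
    push_cast
    rw [mul_div_cancel₀ _ (two_ne_zero), Real.rpow_natCast]
  have h2 : w ^ a = (‖w‖ : ℂ) ^ a * Complex.exp (Complex.I * a * w.arg) := by
    conv_lhs => rw [← Complex.norm_mul_exp_arg_mul_I w]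
    rw [mul_pow, ← Complex.exp_nat_mul]
    ring_nf
  have h3 : (√(q.factorial : ℝ))⁻¹ * q.factorial = √(q.factorial : ℝ) := by
    have : (√(q.factorial : ℝ)) ≠ 0 := by positivity
    field_simp
    rw [Real.sq_sqrt (by positivity)]
  have h4 : ((√(q.factorial : ℝ) : ℝ) : ℂ)⁻¹ * q.factorial = (√(q.factorial : ℝ) : ℝ) := by
    exact_mod_cast h3
  rw [h1, h2, Real.sqrt_div (by positivity)]
  push_cast
  linear_combination ((√((q + a).factorial : ℝ) : ℂ)⁻¹ * (‖w‖ : ℂ) ^ a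
    * Complex.exp (-(‖w‖ : ℂ) ^ 2 / 2) * Complex.exp (Complex.I * a * w.arg)
    * (genLaguerre q a (‖w‖ ^ 2) : ℝ)) * h4

theorem dispCoeff_add_right (q a : ℕ) (w : ℂ) :
    dispCoeff q (q + a) w = (-1) ^ a * ((laguerreFun q a (‖w‖ ^ 2) : ℝ)
      * Complex.exp (-(Complex.I * a * w.arg))) := by
  have h : dispCoeff q (q + a) w = (-1) ^ a * conj (dispCoeff (q + a) q w) := by
    rw [conj_dispCoeff, dispCoeff, dispCoeff, map_neg, ladderPoly_neg_neg, norm_neg]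
    have : ((-1 : ℂ) ^ a) * (-1) ^ (q + (q + a)) = 1 := by
      rw [← pow_add, show a + (q + (q + a)) = 2 * (q + a) by ring, pow_mul]; simp
    linear_combination (-(((√(q.factorial : ℝ))⁻¹ * (√((q + a).factorial : ℝ))⁻¹
      * Real.exp (-‖w‖ ^ 2 / 2) : ℝ) : ℂ) * ladderPoly w (-conj w) q (q + a)) * this
  rw [h, dispCoeff_add_left, map_mul, Complex.conj_ofReal, ← Complex.exp_conj]
  simp

theorem expLaguerrePlane_natCast {r : ℕ} (q a : ℕ) (z : ℂ) (τ : EuclideanSpace ℝ (Fin r))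
    (hτ : 0 < ‖τ‖) :
    expLaguerrePlane q (a : ℤ) z τ
      = ((2 * ‖τ‖ / Real.pi : ℝ) : ℂ) * dispCoeff (q + a) q ((√(2 * ‖τ‖) : ℝ) * z) := by
  have h0 : 0 < √(2 * ‖τ‖) := by positivity
  have hs : (((a : ℤ).sign : ℤ) : ℝ) ^ (a : ℤ) = 1 := by
    rcases a with _ | a
    · simp
    · rw [Int.sign_eq_one_of_pos (by positivity)]; simp
  rw [expLaguerrePlane, dispCoeff_add_left, hs, Complex.arg_real_mul _ h0, norm_mul, mul_pow,
    Complex.norm_real, Real.norm_of_nonneg h0.le, Real.sq_sqrt (by positivity)]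
  simp
  ring

theorem expLaguerrePlane_neg_natCast {r : ℕ} (q a : ℕ) (z : ℂ) (τ : EuclideanSpace ℝ (Fin r))
    (hτ : 0 < ‖τ‖) :
    expLaguerrePlane q (-(a : ℤ)) z τ
      = ((2 * ‖τ‖ / Real.pi : ℝ) : ℂ) * dispCoeff q (q + a) ((√(2 * ‖τ‖) : ℝ) * z) := by
  have h0 : 0 < √(2 * ‖τ‖) := by positivity
  have hs : (((-(a : ℤ)).sign : ℤ) : ℝ) ^ (-(a : ℤ)) = (-1) ^ a := by
    rcases a with _ | a
    · simp
    · rw [Int.sign_eq_neg_one_of_neg (by omega), zpow_neg, zpow_natCast]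
      push_cast
      rw [← inv_pow]; norm_num
  rw [expLaguerrePlane, dispCoeff_add_right, hs, Complex.arg_real_mul _ h0, norm_mul, mul_pow,
    Complex.norm_real, Real.norm_of_nonneg h0.le, Real.sq_sqrt (by positivity)]
  simp
  ring

theorem expLaguerrePlane_eq_dispCoeff {r : ℕ} (p k : ℕ+) (z : ℂ) (τ : EuclideanSpace ℝ (Fin r))
    (hτ : 0 < ‖τ‖) {μ : ℝ} (hμ : 0 < μ) :
    ((μ / ‖τ‖ : ℝ) : ℂ) * expLaguerrePlane (min p k).natPred ((p : ℕ) - (k : ℕ) : ℤ)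
        ((√(μ / ‖τ‖) : ℝ) * z) τ
      = ((2 * μ / Real.pi : ℝ) : ℂ) * dispCoeff p.natPred k.natPred ((√(2 * μ) : ℝ) * z) := by
  have hsq : √(2 * ‖τ‖) * √(μ / ‖τ‖) = √(2 * μ) := by
    rw [← Real.sqrt_mul (by positivity)]
    congr 1
    field_simp
  have hc : (μ / ‖τ‖) * (2 * ‖τ‖ / Real.pi) = 2 * μ / Real.pi := by
    have := Real.pi_pos
    field_simp
  have hP : p.natPred + 1 = p := p.natPred_add_one
  have hK : k.natPred + 1 = k := k.natPred_add_one
  rcases le_total p k with h | h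
  · have h' : (p : ℕ) ≤ k := h
    obtain ⟨a, ha⟩ : ∃ a, k.natPred = p.natPred + a := ⟨k.natPred - p.natPred, by omega⟩
    have e : ((p : ℕ) - (k : ℕ) : ℤ) = -(a : ℤ) := by omega
    rw [min_eq_left h, e, expLaguerrePlane_neg_natCast _ _ _ _ hτ, ha, ← mul_assoc, ← mul_assoc,
      ← Complex.ofReal_mul, ← Complex.ofReal_mul, hc, hsq]
  · have h' : (k : ℕ) ≤ p := h
    obtain ⟨a, ha⟩ : ∃ a, p.natPred = k.natPred + a := ⟨p.natPred - k.natPred, by omega⟩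
    have e : ((p : ℕ) - (k : ℕ) : ℤ) = (a : ℤ) := by omega
    rw [min_eq_right h, e, expLaguerrePlane_natCast _ _ _ _ hτ, ha, ← mul_assoc, ← mul_assoc,
      ← Complex.ofReal_mul, ← Complex.ofReal_mul, hc, hsq]

/-! ### Normal coordinates and the Laguerre basis -/

/-- A product of `n` absolutely convergent series is the sum over multi-indices of the products of
their terms. -/
theorem hasSum_pi_prod {R ι : Type*} [NormedCommRing R] [CompleteSpace R] [NormOneClass R] {n : ℕ}
    {f : Fin n → ι → R} {a : Fin n → R} (hf : ∀ j, HasSum (f j) (a j))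
    (hn : ∀ j, Summable fun i => ‖f j i‖) :
    HasSum (fun x : Fin n → ι => ∏ j, f j (x j)) (∏ j, a j) ∧
      Summable fun x : Fin n → ι => ‖∏ j, f j (x j)‖ := by
  induction n with
  | zero =>
    simp only [Finset.univ_eq_empty, Finset.prod_empty]
    refine ⟨?_, ?_⟩
    · simp
    · exact (hasSum_fintype _).summable
  | succ n ih =>
    obtain ⟨h1, h2⟩ := ih (fun j => hf j.succ) (fun j => hn j.succ)
    have hs := summable_mul_of_summable_norm (hn 0) h2
    have hsum := (hf 0).mul h1 hs
    have hnorm := (hn 0).mul_norm h2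
    let E : ι × (Fin n → ι) ≃ (Fin (n + 1) → ι) := Fin.consEquiv fun _ => ι
    have hE : ∀ x, ∏ j, f j (E x j) = f 0 x.1 * ∏ j : Fin n, f j.succ (x.2 j) := by
      intro x
      rw [Fin.prod_univ_succ]
      rfl
    rw [← E.hasSum_iff, ← E.summable_iff, Fin.prod_univ_succ]
    constructor
    · convert! hsum using 1
      ext x
      exact hE x
    · convert! hnorm using 1
      ext x
      exact congrArg _ (hE x)

theorem measurePreserving_curry (ι κ : Type*) [Fintype ι] [Fintype κ] :
    MeasurePreserving (MeasurableEquiv.curry ι κ ℝ) volume volume := by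
  refine MeasurePreserving.symm (MeasurableEquiv.curry ι κ ℝ).symm ⟨by fun_prop, ?_⟩
  refine (Measure.pi_eq (μ := fun _ : ι × κ => (volume : Measure ℝ)) fun s hs => ?_).symm
  rw [MeasurableEquiv.map_apply]
  have : (MeasurableEquiv.curry ι κ ℝ).symm ⁻¹' (Set.univ.pi s)
      = Set.univ.pi fun i => Set.univ.pi fun j => s (i, j) := by
    ext x
    simp [Set.mem_pi, MeasurableEquiv.coe_curry_symm, Function.uncurry]
  rw [this, volume_pi_pi, Fintype.prod_prod_type]
  simp_rw [volume_pi_pi]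

theorem integral_comp_sqrt_mul (h : ℂ → ℂ) {s : ℝ} (hs : 0 ≤ s) :
    ∫ z : ℂ, h ((√s : ℝ) * z) = ((s⁻¹ : ℝ) : ℂ) * ∫ z : ℂ, h z := by
  have := Measure.integral_comp_smul (volume : Measure ℂ) h (√s)
  simp only [Complex.real_smul, Complex.finrank_real_complex] at this
  rw [this, Real.sq_sqrt hs, abs_of_nonneg (by positivity)]

namespace SkewMap

variable {n r : ℕ} (B : SkewMap n r) (τ : EuclideanSpace ℝ (Fin r))

/-- The form `B^τ` as a bilinear map. -/
def tauBilin : EuclideanSpace ℝ (Fin (2 * n)) →ₗ[ℝ] EuclideanSpace ℝ (Fin (2 * n)) →ₗ[ℝ] ℝ :=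
  LinearMap.mk₂ ℝ (B.tauForm τ)
    (fun x x' y => by simp only [tauForm, map_add_left, PiLp.add_apply, mul_add,
      Finset.sum_add_distrib])
    (fun c x y => by
      simp only [tauForm, map, PiLp.smul_apply, smul_eq_mul, Finset.mul_sum]
      refine Finset.sum_congr rfl fun β _ => Finset.sum_congr rfl fun k _ =>
        Finset.sum_congr rfl fun l _ => by ring)
    (fun x y y' => by simp only [tauForm, map_add_right, PiLp.add_apply, mul_add,
      Finset.sum_add_distrib])
    (fun c x y => by
      simp only [tauForm, map, PiLp.smul_apply, smul_eq_mul, Finset.mul_sum]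
      refine Finset.sum_congr rfl fun β _ => Finset.sum_congr rfl fun k _ =>
        Finset.sum_congr rfl fun l _ => by ring)

theorem tauBilin_apply (x y : EuclideanSpace ℝ (Fin (2 * n))) :
    B.tauBilin τ x y = B.tauForm τ x y := rfl

theorem tauForm_swap (x y : EuclideanSpace ℝ (Fin (2 * n))) :
    B.tauForm τ y x = -B.tauForm τ x y := by
  simp only [tauForm, B.map_swap x y, PiLp.neg_apply, mul_neg, Finset.sum_neg_distrib]

end SkewMap

namespace NormalizingBasis

variable {n r : ℕ} {B : SkewMap n r} {τ : EuclideanSpace ℝ (Fin r)} (e : NormalizingBasis B τ)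

/-- The complex coordinates `y ↦ (y_{2j-1}^τ + i y_{2j}^τ)_j` as a measurable equivalence with `ℂ^n`. -/
def coordEquiv : EuclideanSpace ℝ (Fin (2 * n)) ≃ᵐ (Fin n → ℂ) :=
  e.v.measurableEquiv.trans <| (MeasurableEquiv.toLp 2 (Fin n × Fin 2 → ℝ)).symm.trans <|
    (MeasurableEquiv.curry (Fin n) (Fin 2) ℝ).trans <|
      MeasurableEquiv.piCongrRight fun _ => Complex.measurableEquivPi.symm

theorem coordEquiv_apply (y : EuclideanSpace ℝ (Fin (2 * n))) : e.coordEquiv y = e.coord y := by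
  ext j
  change Complex.measurableEquivPi.symm _ = _
  rw [Complex.measurableEquivPi_symm_apply, coord, Complex.mk_eq_add_mul_I]
  rfl

theorem measurePreserving_coordEquiv : MeasurePreserving e.coordEquiv volume volume := by
  refine MeasurePreserving.trans e.v.measurePreserving_measurableEquiv ?_
  refine MeasurePreserving.trans (EuclideanSpace.volume_preserving_symm_measurableEquiv_toLp _) ?_
  refine MeasurePreserving.trans (measurePreserving_curry _ _) ?_
  exact volume_preserving_pi fun _ => Complex.volume_preserving_equiv_pi.symm

theorem integral_prod_coord (h : Fin n → ℂ → ℂ) :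
    ∫ y, ∏ j, h j (e.coord y j) = ∏ j, ∫ z, h j z := by
  have := e.measurePreserving_coordEquiv.integral_comp' (fun z : Fin n → ℂ => ∏ j, h j (z j))
  rw [integral_fintype_prod_volume_eq_prod] at this
  simpa only [coordEquiv_apply] using this

theorem integrable_prod_coord {h : Fin n → ℂ → ℂ} (hh : ∀ j, Integrable (h j)) :
    Integrable fun y => ∏ j, h j (e.coord y j) := by
  simpa only [Function.comp_def, coordEquiv_apply] using e.measurePreserving_coordEquiv.integrable_comp_of_integrable
    (g := fun z : Fin n → ℂ => ∏ j, h j (z j)) (Integrable.fintype_prod hh)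

theorem continuous_coord (j : Fin n) : Continuous fun y => e.coord y j := by
  have h : (fun y => e.coord y j)
      = fun y => (e.v.repr y (j, 0) : ℂ) + (e.v.repr y (j, 1) : ℂ) * Complex.I := by
    ext y; exact (Complex.mk_eq_add_mul_I _ _)
  rw [h]
  fun_prop

theorem coord_add (x y : EuclideanSpace ℝ (Fin (2 * n))) (j : Fin n) :
    e.coord (x + y) j = e.coord x j + e.coord y j := by
  apply Complex.ext <;> simp [coord]

theorem inner_eq_sum_coord (x y : EuclideanSpace ℝ (Fin (2 * n))) :
    inner ℝ x y = ∑ j, (conj (e.coord x j) * e.coord y j).re := by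
  rw [← e.v.repr.inner_map_map, PiLp.inner_apply, Fintype.sum_prod_type]
  refine Finset.sum_congr rfl fun j _ => ?_
  simp [coord, mul_comm]

theorem tauForm_basis_left (j : Fin n) (y : EuclideanSpace ℝ (Fin (2 * n))) :
    B.tauForm τ (e.v (j, 0)) y = -(e.mu j * (e.coord y j).im) ∧
      B.tauForm τ (e.v (j, 1)) y = e.mu j * (e.coord y j).re := by
  have h : ∀ a, B.tauForm τ (e.v (j, a)) y
      = ∑ b, e.v.repr y (j, b) * B.tauForm τ (e.v (j, a)) (e.v (j, b)) := by
    intro a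
    conv_lhs => rw [← e.v.sum_repr y]
    rw [← B.tauBilin_apply, map_sum, Fintype.sum_prod_type, Finset.sum_eq_single j]
    · simp [SkewMap.tauBilin_apply]
    · intro k _ hk
      simp [SkewMap.tauBilin_apply, e.form_off j k a _ hk.symm]
    · simp
  rw [h, h]
  simp [Fin.sum_univ_two, e.form_diag, e.form_fst_snd, e.form_snd_fst, coord]
  constructor <;> ring

/-- In complex normal coordinates `B^τ(x, y) = -∑_j μ_j Im(x̄_j y_j)`. -/
theorem tauForm_eq_sum_coord (x y : EuclideanSpace ℝ (Fin (2 * n))) :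
    B.tauForm τ x y = -∑ j, e.mu j * (conj (e.coord x j) * e.coord y j).im := by
  conv_lhs => rw [← e.v.sum_repr x]
  rw [← B.tauBilin_apply, map_sum, LinearMap.sum_apply, Fintype.sum_prod_type,
    ← Finset.sum_neg_distrib]
  refine Finset.sum_congr rfl fun j _ => ?_
  simp only [map_smul, LinearMap.smul_apply, SkewMap.tauBilin_apply, Fin.sum_univ_two, smul_eq_mul,
    (e.tauForm_basis_left j y).1, (e.tauForm_basis_left j y).2]
  simp [coord]
  ring

theorem mu_pos (hB : B.TauNondegenerate τ) (j : Fin n) : 0 < e.mu j := by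
  refine (e.mu_nonneg j).lt_of_ne fun h => ?_
  refine e.v.orthonormal.ne_zero (j, 0) (hB _ fun y => ?_)
  rw [(e.tauForm_basis_left j y).1, ← h]
  simp

theorem norm_pos_of_mu_pos {j : Fin n} (h : 0 < e.mu j) : 0 < ‖τ‖ := by
  refine norm_pos_iff.2 fun h0 => h.ne' ?_
  rw [← e.form_snd_fst j]
  simp [SkewMap.tauForm, h0]

/-- The coordinates `w_j = √(2 μ_j) (y_{2j-1}^τ + i y_{2j}^τ)`, in which
`2 B^τ(x, y) = -∑_j Im(w_j(x)‾ w_j(y))`. -/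
def scaledCoord (y : EuclideanSpace ℝ (Fin (2 * n))) (j : Fin n) : ℂ :=
  (√(2 * e.mu j) : ℝ) * e.coord y j

/-- The constant `∏_j 2 μ_j / π`. It is at once the factor between `ℓ_{p,k}` and the product of the
`D_{p_j-1,k_j-1}(w_j)`, and the value of `‖ℓ_{p,k}‖²`. -/
def density : ℝ := ∏ j, 2 * e.mu j / Real.pi

theorem density_pos (hμ : ∀ j, 0 < e.mu j) : 0 < e.density :=
  Finset.prod_pos fun j _ => by have := hμ j; have := Real.pi_pos; positivity

/-- The Laguerre basis consists of matrix coefficients, rescaled by `density`. -/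
theorem basisFun_eq (hμ : ∀ j, 0 < e.mu j) (p k : Fin n → ℕ+)
    (y : EuclideanSpace ℝ (Fin (2 * n))) :
    e.basisFun p k y
      = e.density * ∏ j, dispCoeff (p j).natPred (k j).natPred (e.scaledCoord y j) := by
  rw [density, Complex.ofReal_prod, ← Finset.prod_mul_distrib]
  exact Finset.prod_congr (rfl : Finset.univ = Finset.univ) fun j _ => expLaguerrePlane_eq_dispCoeff (p j) (k j) (e.coord y j) τ
    (e.norm_pos_of_mu_pos (hμ j)) (hμ j)

theorem continuous_scaledCoord (j : Fin n) : Continuous fun y => e.scaledCoord y j :=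
  continuous_const.mul (e.continuous_coord j)

theorem continuous_basisFun (hμ : ∀ j, 0 < e.mu j) (p k : Fin n → ℕ+) :
    Continuous (e.basisFun p k) := by
  rw [funext (e.basisFun_eq hμ p k)]
  exact continuous_const.mul (continuous_finsetProd _ fun j _ =>
    (continuous_dispCoeff _ _).comp (e.continuous_scaledCoord j))

theorem norm_basisFun_le (hμ : ∀ j, 0 < e.mu j) (p k : Fin n → ℕ+)
    (y : EuclideanSpace ℝ (Fin (2 * n))) : ‖e.basisFun p k y‖ ≤ e.density := by
  rw [e.basisFun_eq hμ, norm_mul, norm_prod, Complex.norm_real,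
    Real.norm_of_nonneg (e.density_pos hμ).le]
  exact mul_le_of_le_one_right (e.density_pos hμ).le
    (Finset.prod_le_one (fun _ _ => norm_nonneg _) fun _ _ => norm_dispCoeff_le_one _ _ _)

theorem integral_basisFun_mul_conj (hμ : ∀ j, 0 < e.mu j) (p k p' k' : Fin n → ℕ+) :
    ∫ y, e.basisFun p k y * conj (e.basisFun p' k' y)
      = if p = p' ∧ k = k' then (e.density : ℂ) else 0 := by
  have h : ∀ y, e.basisFun p k y * conj (e.basisFun p' k' y)
      = ∏ j, (fun z : ℂ => ((2 * e.mu j / Real.pi : ℝ) : ℂ) ^ 2 *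
          (fun w => dispCoeff (p j).natPred (k j).natPred w
            * conj (dispCoeff (p' j).natPred (k' j).natPred w)) ((√(2 * e.mu j) : ℝ) * z))
          (e.coord y j) := by
    intro y
    rw [e.basisFun_eq hμ, e.basisFun_eq hμ, density, Complex.ofReal_prod, map_mul, map_prod,
      map_prod, ← Finset.prod_mul_distrib, ← Finset.prod_mul_distrib, ← Finset.prod_mul_distrib]
    refine Finset.prod_congr rfl fun j _ => ?_
    simp only [Complex.conj_ofReal, scaledCoord]
    ring
  simp_rw [h]
  rw [e.integral_prod_coord (fun j (z : ℂ) => ((2 * e.mu j / Real.pi : ℝ) : ℂ) ^ 2 *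
          (fun w => dispCoeff (p j).natPred (k j).natPred w
            * conj (dispCoeff (p' j).natPred (k' j).natPred w)) ((√(2 * e.mu j) : ℝ) * z))]
  simp_rw [integral_const_mul]
  have h2 : ∀ j, ∫ z : ℂ, dispCoeff (p j).natPred (k j).natPred ((√(2 * e.mu j) : ℝ) * z)
            * conj (dispCoeff (p' j).natPred (k' j).natPred ((√(2 * e.mu j) : ℝ) * z))
      = (((2 * e.mu j)⁻¹ : ℝ) : ℂ) * if p j = p' j ∧ k j = k' j then (Real.pi : ℂ) else 0 := by
    intro j
    have := integral_comp_sqrt_mul (fun w => dispCoeff (p j).natPred (k j).natPred w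
            * conj (dispCoeff (p' j).natPred (k' j).natPred w)) (s := 2 * e.mu j)
            (by linarith [hμ j])
    rw [this, integral_dispCoeff_mul_conj]
    simp only [PNat.natPred_inj]
  simp_rw [h2]
  split_ifs with hpk
  · obtain ⟨rfl, rfl⟩ := hpk
    simp only [and_self, if_true]
    rw [density, Complex.ofReal_prod]
    refine Finset.prod_congr rfl fun j _ => ?_
    have h3 : (e.mu j : ℂ) ≠ 0 := by exact_mod_cast (hμ j).ne'
    have h4 : (Real.pi : ℂ) ≠ 0 := by exact_mod_cast Real.pi_pos.ne'
    push_cast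
    field_simp
  · have : ∃ j, ¬ (p j = p' j ∧ k j = k' j) := by
      by_contra! hc
      exact hpk ⟨funext fun j => (hc j).1, funext fun j => (hc j).2⟩
    obtain ⟨j, hj⟩ := this
    exact Finset.prod_eq_zero (Finset.mem_univ j) (by rw [if_neg hj]; simp)

end NormalizingBasis

/-! ### The Fourier transform on `L¹ ∩ L²` -/

section Fourier
open scoped FourierTransform SchwartzMap ContDiff

variable {V : Type*} [NormedAddCommGroup V] [InnerProductSpace ℝ V] [FiniteDimensional ℝ V]
  [MeasurableSpace V] [BorelSpace V]

theorem integral_fourier_schwartz_smul_eq (φ : 𝓢(V, ℂ)) {h : V → ℂ} (hh : Integrable h) :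
    ∫ ξ, 𝓕 φ ξ • h ξ = ∫ x, φ x • 𝓕 h x := by
  simpa using! VectorFourier.integral_fourierIntegral_smul_eq_flip (L := innerₗ V)
    Real.continuous_fourierChar continuous_inner φ.integrable hh

theorem continuous_fourier_of_integrable {h : V → ℂ} (hh : Integrable h) : Continuous (𝓕 h) :=
  VectorFourier.fourierIntegral_continuous Real.continuous_fourierChar
    (by exact continuous_inner) hh

theorem ae_eq_of_integral_schwartz_smul_eq {f g : V → ℂ} (hf : LocallyIntegrable f)
    (hg : LocallyIntegrable g) (h : ∀ φ : 𝓢(V, ℂ), ∫ x, φ x • f x = ∫ x, φ x • g x) :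
    f =ᵐ[volume] g := by
  refine ae_eq_of_integral_contDiff_smul_eq hf hg fun u u_smooth u_cpt => ?_
  have h₁ : HasCompactSupport (Complex.ofRealCLM ∘ u) := u_cpt.comp_left rfl
  have h₂ : ContDiff ℝ ∞ (Complex.ofRealCLM ∘ u) := by fun_prop
  simpa using h (h₁.toSchwartzMap h₂)

/-- The Fourier transform is injective on `L¹`. -/
theorem ae_eq_zero_of_fourier_eq_zero {h : V → ℂ} (hh : Integrable h) (h0 : ∀ ξ, 𝓕 h ξ = 0) :
    h =ᵐ[volume] 0 := by
  refine ae_eq_of_integral_schwartz_smul_eq hh.locallyIntegrable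
    (integrable_zero V ℂ volume).locallyIntegrable fun φ => ?_
  have := integral_fourier_schwartz_smul_eq (𝓕⁻ φ) hh
  rw [FourierTransform.fourier_fourierInv_eq] at this
  rw [this]
  simp [h0]

/-- Plancherel's identity for the Fourier integral on `L¹ ∩ L²`. The transform of the `L²` class agrees
with the Fourier integral because both have the same integrals against Schwartz functions. -/
theorem eLpNorm_fourier_eq {h : V → ℂ} (hh : Integrable h) (h2 : MemLp h 2) :
    eLpNorm (𝓕 h) 2 volume = eLpNorm h 2 volume := by
  have hae : 𝓕 h =ᵐ[volume] ((𝓕 (h2.toLp h) : Lp (α := V) ℂ 2 volume) : V → ℂ) := by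
    refine ae_eq_of_integral_schwartz_smul_eq
      (continuous_fourier_of_integrable hh).locallyIntegrable
      ((Lp.memLp _).locallyIntegrable one_le_two) fun φ => ?_
    have h3 := congrArg (fun T : 𝓢'(V, ℂ) => T φ)
      (Lp.fourier_toTemperedDistribution_eq (h2.toLp h))
    simp only [TemperedDistribution.fourier_apply, Lp.toTemperedDistribution_apply] at h3
    rw [← h3, ← integral_fourier_schwartz_smul_eq φ hh]
    refine integral_congr_ae ?_
    filter_upwards [h2.coeFn_toLp] with x hx
    rw [hx]
  rw [eLpNorm_congr_ae hae]
  have h4 := Lp.norm_fourier_eq (h2.toLp h)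
  rw [Lp.norm_def, Lp.norm_def, ENNReal.toReal_eq_toReal_iff' (Lp.eLpNorm_ne_top _)
    (Lp.eLpNorm_ne_top _)] at h4
  rw [h4]
  exact eLpNorm_congr_ae h2.coeFn_toLp

end Fourier

/-! ### Expansions in complete orthogonal families -/

section Expansion

variable {α I : Type*} [DecidableEq I] [MeasurableSpace α] {μ : Measure α}

/-- The expansion of an `L²` function in a complete orthogonal family of functions, all of squared
norm `N`. -/
theorem summable_and_tendsto_of_orthogonal {u : I → α → ℂ} (hu : ∀ i, MemLp (u i) 2 μ) {N : ℝ} (hN : 0 < N)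
    (horth : ∀ i j, ∫ y, u i y * conj (u j y) ∂μ = if i = j then (N : ℂ) else 0)
    (hcompl : ∀ f : α → ℂ, MemLp f 2 μ → (∀ i, ∫ y, f y * conj (u i y) ∂μ = 0) → f =ᵐ[μ] 0)
    {f : α → ℂ} (hf : MemLp f 2 μ) :
    Summable (fun i => ‖(∫ y, f y * conj (u i y) ∂μ) / (N : ℂ)‖ ^ 2) ∧
      Tendsto (fun S : Finset I => eLpNorm (fun y => f y -
        ∑ i ∈ S, (∫ y, f y * conj (u i y) ∂μ) / (N : ℂ) * u i y) 2 μ) atTop (𝓝 0) := by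
  have hN' : (N : ℂ) ≠ 0 := by exact_mod_cast hN.ne'
  have hsN : ((√N : ℝ) : ℂ) * (√N : ℝ) = N := by
    rw [← Complex.ofReal_mul, Real.mul_self_sqrt hN.le]
  have hsN0 : ((√N : ℝ) : ℂ) ≠ 0 := by exact_mod_cast (Real.sqrt_pos.2 hN).ne'
  let b : I → Lp ℂ 2 μ := fun i => ((√N : ℝ) : ℂ)⁻¹ • (hu i).toLp (u i)
  have hinner : ∀ i (g : Lp ℂ 2 μ),
      inner ℂ (b i) g = ((√N : ℝ) : ℂ)⁻¹ * ∫ y, g y * conj (u i y) ∂μ := by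
    intro i g
    rw [inner_smul_left, L2.inner_def, map_inv₀, Complex.conj_ofReal]
    congr 1
    refine integral_congr_ae ?_
    filter_upwards [(hu i).coeFn_toLp] with y hy
    rw [hy, RCLike.inner_apply]
  have hb : Orthonormal ℂ b := by
    rw [orthonormal_iff_ite]
    intro i j
    rw [hinner]
    have : ∫ y, (b j : α → ℂ) y * conj (u i y) ∂μ
        = ((√N : ℝ) : ℂ)⁻¹ * ∫ y, u j y * conj (u i y) ∂μ := by
      rw [← integral_const_mul]
      refine integral_congr_ae ?_
      filter_upwards [Lp.coeFn_smul ((√N : ℝ) : ℂ)⁻¹ ((hu j).toLp (u j)),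
        (hu j).coeFn_toLp] with y hy hy'
      rw [hy, Pi.smul_apply, hy', smul_eq_mul, mul_assoc]
    rw [this, horth]
    by_cases h : i = j
    · rw [if_pos h, if_pos h.symm, ← hsN]; field_simp
    · rw [if_neg h, if_neg (Ne.symm h)]; simp
  have hbot : (Submodule.span ℂ (Set.range b))ᗮ = ⊥ := by
    rw [Submodule.eq_bot_iff]
    intro g hg
    rw [Lp.eq_zero_iff_ae_eq_zero]
    refine hcompl g (Lp.memLp g) fun i => ?_
    have := (Submodule.mem_orthogonal _ _).1 hg (b i) (Submodule.subset_span ⟨i, rfl⟩)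
    rw [hinner] at this
    exact (mul_eq_zero.1 this).resolve_left (inv_ne_zero hsN0)
  let HB := HilbertBasis.mkOfOrthogonalEqBot hb hbot
  have hHB : ⇑HB = b := HilbertBasis.coe_mkOfOrthogonalEqBot hb hbot
  let g := hf.toLp f
  have hc : ∀ i, inner ℂ (b i) g = ((√N : ℝ) : ℂ) * ((∫ y, f y * conj (u i y) ∂μ) / (N : ℂ)) := by
    intro i
    rw [hinner]
    have : ∫ y, (g : α → ℂ) y * conj (u i y) ∂μ = ∫ y, f y * conj (u i y) ∂μ := by
      refine integral_congr_ae ?_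
      filter_upwards [hf.coeFn_toLp] with y hy
      rw [hy]
    rw [this, ← hsN]
    field_simp
  constructor
  · have h1 := hb.inner_products_summable g
    have h2 : ∀ i, ‖(∫ y, f y * conj (u i y) ∂μ) / (N : ℂ)‖ ^ 2 = N⁻¹ * ‖inner ℂ (b i) g‖ ^ 2 := by
      intro i
      rw [hc, norm_mul, mul_pow, Complex.norm_real, Real.norm_of_nonneg (Real.sqrt_nonneg _),
        Real.sq_sqrt hN.le, inv_mul_cancel_left₀ hN.ne']
    simp_rw [h2]
    exact h1.mul_left _
  · have h1 : HasSum (fun i => inner ℂ (b i) g • b i) g := by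
      have := HB.hasSum_repr g
      simpa only [HB.repr_apply_apply, hHB] using this
    have h2 : Tendsto (fun S : Finset I => edist g (∑ i ∈ S, inner ℂ (b i) g • b i)) atTop
        (𝓝 0) := by
      have := tendsto_iff_edist_tendsto_0.1 h1
      rw [SummationFilter.unconditional_filter] at this
      simpa only [edist_comm] using this
    refine h2.congr fun S => ?_
    rw [Lp.edist_def]
    refine eLpNorm_congr_ae ?_
    have h3 : ∀ S : Finset I, (∑ i ∈ S, inner ℂ (b i) g • b i : Lp ℂ 2 μ) =ᵐ[μ]
        fun y => ∑ i ∈ S, (∫ y, f y * conj (u i y) ∂μ) / (N : ℂ) * u i y := by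
      intro S
      induction S using Finset.induction_on with
      | empty =>
        simp only [Finset.sum_empty]
        exact Lp.coeFn_zero ℂ 2 μ
      | insert i S hi ih =>
        rw [Finset.sum_insert hi]
        have h4 : inner ℂ (b i) g • b i
            = ((∫ y, f y * conj (u i y) ∂μ) / (N : ℂ)) • (hu i).toLp (u i) := by
          rw [hc, smul_smul]
          congr 1
          field_simp
        rw [h4]
        filter_upwards [Lp.coeFn_add (((∫ y, f y * conj (u i y) ∂μ) / (N : ℂ)) •
          (hu i).toLp (u i)) (∑ i ∈ S, inner ℂ (b i) g • b i), ih, (hu i).coeFn_toLp,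
          Lp.coeFn_smul ((∫ y, f y * conj (u i y) ∂μ) / (N : ℂ)) ((hu i).toLp (u i))]
          with y e1 e2 e3 e4
        rw [e1, Pi.add_apply, e2, e4, Pi.smul_apply, e3, Finset.sum_insert hi, smul_eq_mul]
    filter_upwards [h3 S, hf.coeFn_toLp] with y e1 e2
    rw [Pi.sub_apply, e1, e2]

end Expansion

/-! ### Completeness of the Laguerre basis -/

namespace NormalizingBasis

variable {n r : ℕ} {B : SkewMap n r} {τ : EuclideanSpace ℝ (Fin r)} (e : NormalizingBasis B τ)

theorem memLp_basisFun (hμ : ∀ j, 0 < e.mu j) (p k : Fin n → ℕ+) :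
    MemLp (e.basisFun p k) 2 := by
  rw [memLp_two_iff_integrable_sq_norm (e.continuous_basisFun hμ p k).aestronglyMeasurable]
  have h := e.integral_basisFun_mul_conj hμ p k p k
  rw [if_pos ⟨rfl, rfl⟩] at h
  have hi : Integrable fun y => e.basisFun p k y * conj (e.basisFun p k y) := by
    by_contra hc
    rw [integral_undef hc] at h
    exact (e.density_pos hμ).ne (by exact_mod_cast h)
  refine hi.norm.congr (ae_of_all _ fun y => ?_)
  simp [sq]

theorem integral_norm_basisFun_sq (hμ : ∀ j, 0 < e.mu j) (p k : Fin n → ℕ+) :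
    ∫ y, ‖e.basisFun p k y‖ ^ 2 = e.density := by
  have h := e.integral_basisFun_mul_conj hμ p k p k
  rw [if_pos ⟨rfl, rfl⟩] at h
  have h2 : ∀ y, e.basisFun p k y * conj (e.basisFun p k y)
      = ((‖e.basisFun p k y‖ ^ 2 : ℝ) : ℂ) := fun y => by
    rw [Complex.mul_conj, Complex.normSq_eq_norm_sq]
  simp_rw [h2] at h
  rw [integral_complex_ofReal] at h
  exact_mod_cast h

theorem continuous_majorant (C b : Fin n → ℝ) :
    Continuous fun y => ∏ j, Real.exp (b j + C j * ‖e.scaledCoord y j‖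
      - ‖e.scaledCoord y j‖ ^ 2 / 2) := by
  have := e.continuous_scaledCoord
  fun_prop

theorem memLp_majorant (hμ : ∀ j, 0 < e.mu j) (C b : Fin n → ℝ) :
    MemLp (fun y => ∏ j, Real.exp (b j + C j * ‖e.scaledCoord y j‖
      - ‖e.scaledCoord y j‖ ^ 2 / 2)) 2 := by
  rw [memLp_two_iff_integrable_sq_norm (e.continuous_majorant C b).aestronglyMeasurable]
  have h : ∀ j, Integrable fun z : ℂ => ((Real.exp (2 * b j) *
      Real.exp (2 * C j * √(2 * e.mu j) * ‖z‖ - (2 * e.mu j) * ‖z‖ ^ 2) : ℝ) : ℂ) := fun j =>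
    ((integrable_exp_norm_sub_sq _ _ (by linarith [hμ j])).const_mul _).ofReal
  refine (e.integrable_prod_coord h).norm.congr (ae_of_all _ fun y => ?_)
  simp only []
  rw [norm_prod, norm_prod, ← Finset.prod_pow]
  refine Finset.prod_congr rfl fun j _ => ?_
  rw [Complex.norm_real, Real.norm_of_nonneg (by positivity), Real.norm_of_nonneg (by positivity),
    scaledCoord, norm_mul, Complex.norm_real, Real.norm_of_nonneg (by positivity), mul_pow,
    Real.sq_sqrt (by linarith [hμ j]), ← Real.exp_add, ← Real.exp_nat_mul]
  congr 1
  push_cast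
  ring

/-- The parameters `a_j` for which `a_j w_j(y) - conj(a_j w_j(y))` sum up to `2πi⟨ξ, y⟩`. -/
def freq (ξ : EuclideanSpace ℝ (Fin (2 * n))) (j : Fin n) : ℂ :=
  Complex.I * Real.pi * conj (e.coord ξ j) / (√(2 * e.mu j) : ℝ)

/-- With `a = freq ξ` and `b = conj a`, the generating function is, after conjugation, a Gaussian times
the Fourier character of frequency `ξ`. -/
theorem prod_exp_freq (hμ : ∀ j, 0 < e.mu j) (ξ y : EuclideanSpace ℝ (Fin (2 * n))) :
    conj (∏ j, Complex.exp (e.freq ξ j * conj (e.freq ξ j) + e.freq ξ j * e.scaledCoord y j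
        - conj (e.freq ξ j) * conj (e.scaledCoord y j) - ‖e.scaledCoord y j‖ ^ 2 / 2))
      = (∏ j, Real.exp (‖e.freq ξ j‖ ^ 2) : ℝ)
        * ((∏ j, Real.exp (-‖e.scaledCoord y j‖ ^ 2 / 2) : ℝ)
          * Complex.exp (((-2 * Real.pi * inner ℝ y ξ : ℝ) : ℂ) * Complex.I)) := by
  rw [real_inner_comm, e.inner_eq_sum_coord, Finset.mul_sum, Complex.ofReal_sum, Finset.sum_mul,
    Complex.exp_sum, Complex.ofReal_prod, Complex.ofReal_prod, ← Finset.prod_mul_distrib,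
    ← Finset.prod_mul_distrib, map_prod]
  refine Finset.prod_congr rfl fun j _ => ?_
  rw [Complex.ofReal_exp, Complex.ofReal_exp, ← Complex.exp_add, ← Complex.exp_add,
    ← Complex.exp_conj]
  congr 1
  have h0 : ((√(2 * e.mu j) : ℝ) : ℂ) ≠ 0 := by
    have := Real.sqrt_pos.2 (show 0 < 2 * e.mu j by linarith [hμ j])
    exact_mod_cast this.ne'
  have h1 : e.freq ξ j * e.scaledCoord y j
      = Complex.I * Real.pi * (conj (e.coord ξ j) * e.coord y j) := by
    rw [freq, scaledCoord]
    field_simp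
  have h2 : e.freq ξ j * conj (e.freq ξ j) = ((‖e.freq ξ j‖ ^ 2 : ℝ) : ℂ) := by
    rw [Complex.mul_conj, Complex.normSq_eq_norm_sq]
  rw [← map_mul, h1, h2]
  set c := conj (e.coord ξ j) * e.coord y j
  have h3 : Complex.I * Real.pi * c - conj (Complex.I * Real.pi * c)
      = ((2 * Real.pi * c.re : ℝ) : ℂ) * Complex.I := by
    rw [Complex.sub_conj]
    simp; ring
  have h4 : conj (2 : ℂ) = 2 := Complex.conj_ofNat 2
  rw [add_sub_assoc, h3]
  simp [h4]
  ring

/-- Completeness of the Laguerre basis. A function orthogonal to all `ℓ_{p,k}` is orthogonal to the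
generating functions; so its product with a Gaussian has vanishing Fourier transform. -/
theorem ae_eq_zero_of_forall_integral_basisFun (hμ : ∀ j, 0 < e.mu j)
    {f : EuclideanSpace ℝ (Fin (2 * n)) → ℂ} (hf : MemLp f 2)
    (h0 : ∀ p k, ∫ y, f y * conj (e.basisFun p k y) = 0) : f =ᵐ[volume] 0 := by
  set g : EuclideanSpace ℝ (Fin (2 * n)) → ℝ := fun y =>
    ∏ j, Real.exp (-‖e.scaledCoord y j‖ ^ 2 / 2) with hg
  have hg2 : MemLp g 2 := by
    -- The Gaussian is the majorant with vanishing parameters.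
    have := e.memLp_majorant hμ 0 0
    simpa [hg, neg_div] using this
  have hfg : Integrable fun y => f y * (g y : ℂ) := hf.integrable_mul hg2.ofReal
  have key : ∀ ξ, FourierTransform.fourier (fun y => f y * (g y : ℂ)) ξ = 0 := by
    intro ξ
    set T : (Fin n → ℕ × ℕ) → EuclideanSpace ℝ (Fin (2 * n)) → ℂ := fun x y =>
      ∏ j, genTerm (e.freq ξ j) (conj (e.freq ξ j)) (e.scaledCoord y j) (x j) with hT
    set M : (Fin n → ℕ × ℕ) → EuclideanSpace ℝ (Fin (2 * n)) → ℝ := fun x y =>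
      ∏ j, genMajorant (e.freq ξ j) (conj (e.freq ξ j)) (e.scaledCoord y j) (x j) with hM
    -- Every term of the generating function is a multiple of an element of the Laguerre basis.
    have hTb : ∀ x, ∃ c : ℂ, ∃ p k, ∀ y, T x y = c * e.basisFun p k y := by
      intro x
      refine ⟨(∏ j, (((√((x j).1.factorial : ℝ))⁻¹ : ℝ) : ℂ)
        * (((√((x j).2.factorial : ℝ))⁻¹ : ℝ) : ℂ)
        * ((e.freq ξ j) ^ (x j).1 * (conj (e.freq ξ j)) ^ (x j).2)) * (e.density : ℂ)⁻¹,
        fun j => (x j).1.succPNat, fun j => (x j).2.succPNat, fun y => ?_⟩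
      have hd : (e.density : ℂ) ≠ 0 := by exact_mod_cast (e.density_pos hμ).ne'
      rw [e.basisFun_eq hμ, mul_assoc, inv_mul_cancel_left₀ hd, ← Finset.prod_mul_distrib]
      exact Finset.prod_congr rfl fun j _ => by simp only [genTerm, Nat.natPred_succPNat]
    have hTint : ∀ x, ∫ y, f y * conj (T x y) = 0 := by
      intro x
      obtain ⟨c, p, k, h⟩ := hTb x
      have : ∀ y, f y * conj (T x y) = conj c * (f y * conj (e.basisFun p k y)) := fun y => by
        rw [h, map_mul]; ring
      simp_rw [this]
      rw [integral_const_mul, h0, mul_zero]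
    have hTc : ∀ x, Continuous (T x) := by
      intro x
      obtain ⟨c, p, k, h⟩ := hTb x
      rw [funext h]
      exact continuous_const.mul (e.continuous_basisFun hμ p k)
    have hMsum : ∀ y, HasSum (fun x => M x y) (∏ j, Real.exp (‖e.freq ξ j‖ * ‖conj (e.freq ξ j)‖
        + (‖e.freq ξ j‖ + ‖conj (e.freq ξ j)‖) * ‖e.scaledCoord y j‖
        - ‖e.scaledCoord y j‖ ^ 2 / 2)) := fun y =>
      (hasSum_pi_prod (fun j => hasSum_genMajorant (e.freq ξ j) (conj (e.freq ξ j))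
        (e.scaledCoord y j)) fun j => (hasSum_genMajorant _ _ _).summable.norm).1
    have hTsum : ∀ y, HasSum (fun x => T x y) (∏ j, Complex.exp (e.freq ξ j * conj (e.freq ξ j)
        + e.freq ξ j * e.scaledCoord y j
        - conj (e.freq ξ j) * conj (e.scaledCoord y j) - ‖e.scaledCoord y j‖ ^ 2 / 2)) := fun y =>
      (hasSum_pi_prod (fun j => hasSum_genTerm (e.freq ξ j) (conj (e.freq ξ j))
        (e.scaledCoord y j)) fun j => Summable.of_nonneg_of_le (fun _ => norm_nonneg _)
          (fun x => norm_genTerm_le _ _ _ x) (hasSum_genMajorant _ _ _).summable).1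
    have hlim := hasSum_integral_of_dominated_convergence
      (F := fun x y => f y * conj (T x y)) (fun x y => ‖f y‖ * M x y)
      (fun x => hf.1.mul (Complex.continuous_conj.comp (hTc x)).aestronglyMeasurable)
      (fun x => ae_of_all _ fun y => by
        rw [norm_mul, RCLike.norm_conj, hT, norm_prod]
        exact mul_le_mul_of_nonneg_left
          (Finset.prod_le_prod (fun _ _ => norm_nonneg _) fun j _ => norm_genTerm_le _ _ _ _)
          (norm_nonneg _))
      (ae_of_all _ fun y => (hMsum y).summable.mul_left _)
      (by
        simp_rw [fun y => ((hMsum y).mul_left ‖f y‖).tsum_eq]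
        exact hf.norm.integrable_mul (e.memLp_majorant hμ _ _))
      (ae_of_all _ fun y => ((Complex.hasSum_conj'.2 (hTsum y)).mul_left (f y)))
    simp_rw [hTint] at hlim
    have h3 := hlim.unique hasSum_zero
    rw [Real.fourier_eq']
    have hK : ((∏ j, Real.exp (‖e.freq ξ j‖ ^ 2) : ℝ) : ℂ) ≠ 0 := by
      have : 0 < (∏ j, Real.exp (‖e.freq ξ j‖ ^ 2) : ℝ) :=
        Finset.prod_pos fun _ _ => Real.exp_pos _
      exact_mod_cast this.ne'
    refine (mul_eq_zero.1 (?_ : ((∏ j, Real.exp (‖e.freq ξ j‖ ^ 2) : ℝ) : ℂ) * _ = 0)).resolve_left hK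
    rw [← integral_const_mul, ← h3]
    refine integral_congr_ae (ae_of_all _ fun y => ?_)
    simp only [e.prod_exp_freq hμ, hg, smul_eq_mul]
    ring
  filter_upwards [ae_eq_zero_of_fourier_eq_zero hfg key] with y hy
  have hgy : (g y : ℂ) ≠ 0 := by
    have : 0 < g y := Finset.prod_pos fun _ _ => Real.exp_pos _
    exact_mod_cast this.ne'
  exact (mul_eq_zero.1 hy).resolve_right hgy

theorem coeff_eq (hμ : ∀ j, 0 < e.mu j) (f : EuclideanSpace ℝ (Fin (2 * n)) → ℂ)
    (p k : Fin n → ℕ+) :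
    e.coeff f p k = (∫ y, f y * conj (e.basisFun p k y)) / (e.density : ℂ) := by
  rw [coeff, Matrix.of_apply, e.integral_norm_basisFun_sq hμ]

theorem hasExpansion_coeff (hμ : ∀ j, 0 < e.mu j) {f : EuclideanSpace ℝ (Fin (2 * n)) → ℂ}
    (hf : MemLp f 2) : e.HasExpansion f (e.coeff f) := by
  refine ⟨hf, ?_⟩
  simp only [e.coeff_eq hμ]
  refine summable_and_tendsto_of_orthogonal
    (u := fun i : (Fin n → ℕ+) × (Fin n → ℕ+) => e.basisFun i.1 i.2)
    (fun i => e.memLp_basisFun hμ i.1 i.2) (e.density_pos hμ) (fun i j => ?_)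
    (fun f hf h => e.ae_eq_zero_of_forall_integral_basisFun hμ hf fun p k => h (p, k)) hf
  rw [e.integral_basisFun_mul_conj hμ]
  simp only [Prod.ext_iff]

end NormalizingBasis

/-! ### Existence of normalizing bases -/

section SkewNormalForm

variable {V : Type*} [NormedAddCommGroup V] [InnerProductSpace ℝ V] [FiniteDimensional ℝ V]

/-- A skew-adjoint `S` has an eigenvector of the symmetric operator `S²` in every nonzero invariant
subspace, and the eigenvalue is `-‖Su‖²`. -/
theorem exists_eigenvector_sq_of_skew (S : V →ₗ[ℝ] V)
    (hS : ∀ x y, inner ℝ (S x) y = -inner ℝ x (S y)) (W : Submodule ℝ V) [Nontrivial W]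
    (hW : ∀ w ∈ W, S w ∈ W) : ∃ u ∈ W, ‖u‖ = 1 ∧ S (S u) = -(‖S u‖ ^ 2) • u := by
  let T : W →ₗ[ℝ] W := (S ∘ₗ S).restrict fun w hw => hW _ (hW w hw)
  have hT : T.IsSymmetric := by
    intro x y
    change inner ℝ (S (S x)) (y : V) = inner ℝ (x : V) (S (S y))
    rw [hS, hS, neg_neg]
  obtain ⟨u₀, h₀⟩ := hT.hasEigenvalue_iSup_of_finiteDimensional.exists_hasEigenvector
  set c := (⨆ x : { x : W // x ≠ 0 }, RCLike.re (inner ℝ (T x) (x : W)) / ‖(x : W)‖ ^ 2 : ℝ)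
  have h1 : S (S u₀) = c • (u₀ : V) := congrArg Subtype.val h₀.apply_eq_smul
  have h2 : (u₀ : V) ≠ 0 := fun h => h₀.2 (Subtype.ext h)
  have h3 : ‖(u₀ : V)‖ ≠ 0 := norm_ne_zero_iff.2 h2
  let u : V := (‖(u₀ : V)‖)⁻¹ • (u₀ : V)
  have hu : ‖u‖ = 1 := by rw [norm_smul, norm_inv, norm_norm, inv_mul_cancel₀ h3]
  have h4 : S (S u) = c • u := by
    simp only [u, map_smul, h1]
    rw [smul_comm]
  refine ⟨u, W.smul_mem _ u₀.2, hu, ?_⟩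
  have h5 : c = -(‖S u‖ ^ 2) := by
    have : inner ℝ (S (S u)) u = c := by
      rw [h4, real_inner_smul_left, real_inner_self_eq_norm_sq, hu]; ring
    rw [← this, hS, real_inner_self_eq_norm_sq]
  rw [h4, h5]

/-- Orthonormal pairs on which an injective skew-adjoint operator acts by plane rotations and
dilations; as many pairs as fit are found one after the other, each in the orthogonal complement of
the previous ones. -/
theorem exists_orthonormal_skew_normal_form (S : V →ₗ[ℝ] V) (hinj : Function.Injective S)
    (hS : ∀ x y, inner ℝ (S x) y = -inner ℝ x (S y)) (k : ℕ)
    (hk : 2 * k ≤ Module.finrank ℝ V) :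
    ∃ (v : Fin k × Fin 2 → V) (μ : Fin k → ℝ), Orthonormal ℝ v ∧ (∀ j, 0 ≤ μ j) ∧
      (∀ j, S (v (j, 0)) = -μ j • v (j, 1)) ∧ ∀ j, S (v (j, 1)) = μ j • v (j, 0) := by
  induction k with
  | zero =>
    exact ⟨fun x => x.1.elim0, fun j => j.elim0, ⟨fun x => x.1.elim0, fun x => x.1.elim0⟩,
      fun j => j.elim0, fun j => j.elim0, fun j => j.elim0⟩
  | succ k ih =>
    obtain ⟨v, μ, hv, hμ, hv0, hv1⟩ := ih (by omega)
    let W : Submodule ℝ V := (Submodule.span ℝ (Set.range v))ᗮ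
    have hmem : ∀ w, w ∈ W ↔ ∀ x, inner ℝ (v x) w = 0 := by
      intro w
      constructor
      · intro h x
        exact (Submodule.mem_orthogonal _ _).1 h _ (Submodule.subset_span ⟨x, rfl⟩)
      · intro h
        refine (Submodule.mem_orthogonal _ _).2 fun z hz => ?_
        induction hz using Submodule.span_induction with
        | mem z hz => obtain ⟨x, rfl⟩ := hz; exact h x
        | zero => simp
        | add a b _ _ ha hb => rw [inner_add_left, ha, hb, add_zero]
        | smul c a _ ha => rw [real_inner_smul_left, ha, mul_zero]
    have hW : ∀ w ∈ W, S w ∈ W := by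
      intro w hw
      rw [hmem] at hw ⊢
      rintro ⟨j, a⟩
      have : inner ℝ (v (j, a)) (S w) = -inner ℝ (S (v (j, a))) w := by rw [hS, neg_neg]
      rw [this]
      fin_cases a
      · simp [hv0, real_inner_smul_left, hw]
      · simp [hv1, real_inner_smul_left, hw]
    have hdim : 0 < Module.finrank ℝ W := by
      have h1 := Submodule.finrank_add_finrank_orthogonal (Submodule.span ℝ (Set.range v))
      have h2 := finrank_span_eq_card hv.linearIndependent
      simp only [Fintype.card_prod, Fintype.card_fin] at h2
      change 0 < Module.finrank ℝ ((Submodule.span ℝ (Set.range v))ᗮ : Submodule ℝ V)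
      omega
    have : Nontrivial W := Module.finrank_pos_iff.1 hdim
    obtain ⟨u, huW, hu, hSu⟩ := exists_eigenvector_sq_of_skew S hS W hW
    set m := ‖S u‖ with hm
    have hm0 : m ≠ 0 := by
      rw [hm, norm_ne_zero_iff]
      intro h
      have : u = 0 := hinj (by rw [h, map_zero])
      rw [this, norm_zero] at hu
      exact zero_ne_one hu
    -- The partner of `u`: the sign is chosen so that `S u = -m u'` and `S u' = m u`.
    let u' : V := -(m⁻¹ • S u)
    have hu'W : u' ∈ W := W.neg_mem (W.smul_mem _ (hW u huW))
    have hu' : ‖u'‖ = 1 := by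
      rw [norm_neg, norm_smul, norm_inv, ← hm, Real.norm_of_nonneg (norm_nonneg _),
        inv_mul_cancel₀ hm0]
    have huu' : inner ℝ u u' = 0 := by
      have : inner ℝ u (S u) = 0 := by
        have h := hS u u
        rw [real_inner_comm] at h
        linarith
      rw [inner_neg_right, real_inner_smul_right, this, mul_zero, neg_zero]
    have hu'u : inner ℝ u' u = 0 := by rw [real_inner_comm, huu']
    rw [hmem] at huW hu'W
    have huW' : ∀ x, inner ℝ u (v x) = 0 := fun x => by rw [real_inner_comm, huW]
    have hu'W' : ∀ x, inner ℝ u' (v x) = 0 := fun x => by rw [real_inner_comm, hu'W]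
    refine ⟨fun x => Fin.cases (![u, u'] x.2) (fun j => v (j, x.2)) x.1, Fin.cons m μ, ?_, ?_, ?_,
      ?_⟩
    · rw [orthonormal_iff_ite] at hv ⊢
      rintro ⟨i, a⟩ ⟨j, b⟩
      induction i using Fin.cases with
      | zero =>
        induction j using Fin.cases with
        | zero =>
          fin_cases a <;> fin_cases b <;> simp [hu, hu', huu', hu'u]
        | succ j =>
          fin_cases a <;> simp [huW', hu'W', (Fin.succ_ne_zero j).symm]
      | succ i =>
        induction j using Fin.cases with
        | zero =>
          fin_cases b <;> simp [huW, hu'W]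
        | succ j =>
          simpa using hv (i, a) (j, b)
    · intro j
      induction j using Fin.cases with
      | zero => simp [hm]
      | succ j => simpa using hμ j
    · intro j
      induction j using Fin.cases with
      | zero => simp [u', smul_smul, hm0]
      | succ j => simpa using hv0 j
    · intro j
      induction j using Fin.cases with
      | zero =>
        simp [u', hSu, smul_smul]
        congr 1
        field_simp
      | succ j => simpa using hv1 j

end SkewNormalForm

namespace SkewMap

variable {n r : ℕ} (B : SkewMap n r) (τ : EuclideanSpace ℝ (Fin r))

theorem nonempty_normalizingBasis (hB : B.TauNondegenerate τ) :
    Nonempty (NormalizingBasis B τ) := by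
  let S : EuclideanSpace ℝ (Fin (2 * n)) →ₗ[ℝ] EuclideanSpace ℝ (Fin (2 * n)) :=
    (InnerProductSpace.toDual ℝ (EuclideanSpace ℝ (Fin (2 * n)))).symm.toLinearEquiv.toLinearMap ∘ₗ
      (LinearMap.toContinuousLinearMap.toLinearMap ∘ₗ B.tauBilin τ)
  have hSB : ∀ x y, inner ℝ (S x) y = B.tauForm τ x y := by
    intro x y
    exact InnerProductSpace.toDual_symm_apply
  have hS : ∀ x y, inner ℝ (S x) y = -inner ℝ x (S y) := by
    intro x y
    rw [real_inner_comm (S y) x, hSB, hSB, B.tauForm_swap]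
  have hinj : Function.Injective S := by
    rw [injective_iff_map_eq_zero]
    intro x hx
    exact hB x fun y => by rw [← hSB, hx, inner_zero_left]
  have hfr : Module.finrank ℝ (EuclideanSpace ℝ (Fin (2 * n))) = 2 * n := by simp
  obtain ⟨v, μ, hv, hμ, hv0, hv1⟩ :=
    exists_orthonormal_skew_normal_form S hinj hS n hfr.ge
  have hspan : ⊤ ≤ Submodule.span ℝ (Set.range v) :=
    (hv.linearIndependent.span_eq_top_of_card_eq_finrank' (by simp [mul_comm])).ge
  have hvv := orthonormal_iff_ite.1 hv
  refine ⟨⟨OrthonormalBasis.mk hv hspan, μ, hμ, ?_, ?_, ?_, ?_⟩⟩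
  · intro j
    simp [← hSB, hv0, real_inner_smul_left, hv.norm_eq_one]
  · intro j
    simp [← hSB, hv1, real_inner_smul_left, hv.norm_eq_one]
  · intro j a
    have := B.tauForm_swap τ ((OrthonormalBasis.mk hv hspan) (j, a))
      ((OrthonormalBasis.mk hv hspan) (j, a))
    linarith
  · intro j k a b hjk
    fin_cases a
    · simp [← hSB, hv0, real_inner_smul_left, hvv, hjk]
    · simp [← hSB, hv1, real_inner_smul_left, hvv, hjk]

end SkewMap

/-! ### The group and its convolution -/

theorem SkewMap.continuous_map {n r : ℕ} (B : SkewMap n r) :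
    Continuous fun x : EuclideanSpace ℝ (Fin (2 * n)) × EuclideanSpace ℝ (Fin (2 * n)) =>
      B.map x.1 x.2 := by
  unfold SkewMap.map
  refine (PiLp.continuous_toLp 2 _).comp ?_
  fun_prop

theorem SkewMap.inner_map {n r : ℕ} (B : SkewMap n r) (τ : EuclideanSpace ℝ (Fin r))
    (x y : EuclideanSpace ℝ (Fin (2 * n))) : inner ℝ τ (B.map x y) = B.tauForm τ x y := by
  rw [PiLp.inner_apply, SkewMap.tauForm]
  exact Finset.sum_congr rfl fun β _ => by simp [mul_comm]

theorem SkewMap.measurable_map_right {n r : ℕ} (B : SkewMap n r)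
    (a : EuclideanSpace ℝ (Fin (2 * n))) : Measurable (B.map a) := by
  have hc : Continuous fun x : EuclideanSpace ℝ (Fin (2 * n)) => (a, x) := by fun_prop
  exact (B.continuous_map.comp hc).measurable

theorem measurePreserving_add_shear {X Y : Type*} [AddGroup X] [AddCommGroup Y] [MeasurableSpace X]
    [MeasurableSpace Y] [MeasurableAdd₂ X] [MeasurableAdd₂ Y] (μ : Measure X) (ν : Measure Y)
    [SFinite μ] [SFinite ν] [μ.IsAddLeftInvariant] [ν.IsAddLeftInvariant] (a : X) (b : Y)
    {φ : X → Y} (hφ : Measurable φ) :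
    MeasurePreserving (fun z : X × Y => (a + z.1, b + z.2 + φ z.1)) (μ.prod ν) (μ.prod ν) := by
  refine (measurePreserving_add_left μ a).skew_product (g := fun x t => b + t + φ x) ?_
    (ae_of_all _ fun x => ?_)
  · exact (measurable_const.add measurable_snd).add (hφ.comp measurable_fst)
  · have h3 : (fun t => b + t + φ x) = fun t => (b + φ x) + t := by
      ext1 t; abel
    rw [h3]
    exact map_add_left_eq_self ν _

/-- The Cauchy–Schwarz inequality with a weight `a`. -/
theorem lintegral_mul_sq_le {α : Type*} [MeasurableSpace α] {μ : Measure α} {a b : α → ENNReal}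
    (ha : AEMeasurable a μ) (hb : AEMeasurable b μ) :
    (∫⁻ x, a x * b x ∂μ) ^ 2 ≤ (∫⁻ x, a x ∂μ) * ∫⁻ x, a x * b x ^ 2 ∂μ := by
  have h := ENNReal.lintegral_mul_le_Lp_mul_Lq μ Real.HolderConjugate.two_two
    (ha.pow_const (1 / 2 : ℝ)) ((ha.pow_const (1 / 2 : ℝ)).mul hb)
  have e1 : ∀ x : ENNReal, (x ^ (1 / 2 : ℝ)) * x ^ (1 / 2 : ℝ) = x := fun x => by
    rw [← ENNReal.rpow_add_of_nonneg _ _ (by norm_num) (by norm_num)]; norm_num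
  have e2 : ∀ x : ENNReal, (x ^ (1 / 2 : ℝ)) ^ 2 = x := fun x => by rw [sq, e1]
  simp only [Pi.mul_apply, ENNReal.rpow_two, mul_pow, ← mul_assoc, e1, e2] at h
  calc _ ≤ ((∫⁻ x, a x ∂μ) ^ (1 / 2 : ℝ) * (∫⁻ x, a x * b x ^ 2 ∂μ) ^ (1 / 2 : ℝ)) ^ 2 := by
        gcongr
    _ = _ := by rw [mul_pow, e2, e2]

theorem eLpNorm_two_sq {α : Type*} [MeasurableSpace α] {μ : Measure α} (f : α → ℂ) :
    eLpNorm f 2 μ ^ 2 = ∫⁻ x, ‖f x‖ₑ ^ 2 ∂μ := by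
  have := eLpNorm_nnreal_pow_eq_lintegral (μ := μ) (f := f) (p := 2) two_ne_zero
  simpa using this

theorem memLp_two_iff_lintegral {α : Type*} [MeasurableSpace α] {μ : Measure α} {f : α → ℂ}
    (hf : AEStronglyMeasurable f μ) : MemLp f 2 μ ↔ ∫⁻ x, ‖f x‖ₑ ^ 2 ∂μ < ⊤ := by
  rw [← eLpNorm_two_sq, MemLp, and_iff_right hf]
  simp [ENNReal.pow_lt_top_iff]

namespace StepTwoGroup

variable {n r : ℕ} {B : SkewMap n r}

instance : SigmaFinite (volume : Measure (StepTwoGroup B)) :=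
  inferInstanceAs (SigmaFinite
    (volume : Measure (EuclideanSpace ℝ (Fin (2 * n)) × EuclideanSpace ℝ (Fin r))))

theorem measurable_fst : Measurable fun g : StepTwoGroup B => g.1 := _root_.measurable_fst

theorem measurable_snd : Measurable fun g : StepTwoGroup B => g.2 := _root_.measurable_snd

theorem measurable_mk {α : Type*} [MeasurableSpace α] {f : α → EuclideanSpace ℝ (Fin (2 * n))}
    {g : α → EuclideanSpace ℝ (Fin r)} (hf : Measurable f) (hg : Measurable g) :
    Measurable fun a => (mk (f a) (g a) : StepTwoGroup B) := hf.prodMk hg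

instance : MeasurableMul₂ (StepTwoGroup B) where
  measurable_mul := by
    have h1 : Measurable fun p : StepTwoGroup B × StepTwoGroup B => p.1.1 :=
      measurable_fst.comp _root_.measurable_fst
    have h2 : Measurable fun p : StepTwoGroup B × StepTwoGroup B => p.1.2 :=
      measurable_snd.comp _root_.measurable_fst
    have h3 : Measurable fun p : StepTwoGroup B × StepTwoGroup B => p.2.1 :=
      measurable_fst.comp _root_.measurable_snd
    have h4 : Measurable fun p : StepTwoGroup B × StepTwoGroup B => p.2.2 :=
      measurable_snd.comp _root_.measurable_snd
    exact measurable_mk (h1.add h3)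
      ((h2.add h4).add ((B.continuous_map.measurable.comp (h1.prodMk h3)).const_smul (2 : ℝ)))

instance : MeasurableInv (StepTwoGroup B) where
  measurable_inv := measurable_mk measurable_fst.neg measurable_snd.neg

instance : (volume : Measure (StepTwoGroup B)).IsMulLeftInvariant where
  map_mul_left_eq_self h := (measurePreserving_add_shear
    (volume : Measure (EuclideanSpace ℝ (Fin (2 * n)))) (volume : Measure (EuclideanSpace ℝ (Fin r)))
    h.1 h.2 ((B.measurable_map_right h.1).const_smul (2 : ℝ))).map_eq

theorem integrable_mul_shear {F G : StepTwoGroup B → ℂ} (hF : Integrable F) (hG : Integrable G) :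
    Integrable (fun z : StepTwoGroup B × StepTwoGroup B => F z.1 * G (z.1⁻¹ * z.2))
      (volume.prod volume) :=
  (measurePreserving_prod_inv_mul volume volume).integrable_comp_of_integrable (hF.mul_prod hG)

theorem integrable_conv {F G : StepTwoGroup B → ℂ} (hF : Integrable F) (hG : Integrable G) :
    Integrable (conv F G) :=
  (integrable_mul_shear hF hG).integral_prod_right

theorem integral_conv_mul {F G χ : StepTwoGroup B → ℂ} (hF : Integrable F) (hG : Integrable G)
    (hχ : Measurable χ) {C : ℝ} (hC : ∀ g, ‖χ g‖ ≤ C) :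
    ∫ g, conv F G g * χ g = ∫ h, ∫ k, F h * (G k * χ (h * k)) := by
  have h1 : Integrable (fun z : StepTwoGroup B × StepTwoGroup B =>
      F z.1 * G (z.1⁻¹ * z.2) * χ z.2) (volume.prod volume) :=
    (integrable_mul_shear hF hG).mul_bdd (c := C) (hχ.comp _root_.measurable_snd).aestronglyMeasurable
      (ae_of_all _ fun z => hC _)
  calc ∫ g, conv F G g * χ g = ∫ g, ∫ h, F h * G (h⁻¹ * g) * χ g := by
        simp only [conv, integral_mul_const]
    _ = ∫ h, ∫ g, F h * G (h⁻¹ * g) * χ g := (integral_integral_swap h1).symm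
    _ = ∫ h, ∫ k, F h * (G k * χ (h * k)) := by
        refine integral_congr_ae (ae_of_all _ fun h => ?_)
        simp only []
        rw [← integral_mul_left_eq_self (fun g => F h * G (h⁻¹ * g) * χ g) h]
        simp only [inv_mul_cancel_left, mul_assoc]

/-- Young's inequality `L¹ * L² ⊆ L²` on the group. -/
theorem memLp_two_conv {F G : StepTwoGroup B → ℂ} (hF : Integrable F) (hG : Integrable G)
    (hG2 : MemLp G 2) : MemLp (conv F G) 2 := by
  rw [memLp_two_iff_lintegral (integrable_conv hF hG).1]
  have hGm : AEStronglyMeasurable (fun z : StepTwoGroup B × StepTwoGroup B => G (z.1⁻¹ * z.2))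
      (volume.prod volume) :=
    (hG.1.comp_snd (μ := volume)).comp_measurePreserving
      (measurePreserving_prod_inv_mul volume volume)
  have hpt : ∀ᵐ g, ‖conv F G g‖ₑ ^ 2 ≤ (∫⁻ h, ‖F h‖ₑ) * ∫⁻ h, ‖F h‖ₑ * ‖G (h⁻¹ * g)‖ₑ ^ 2 := by
    filter_upwards [hGm.prod_swap.prodMk_left] with g hg
    refine le_trans ?_ (lintegral_mul_sq_le hF.1.enorm hg.enorm)
    gcongr
    refine (enorm_integral_le_lintegral_enorm _).trans_eq ?_
    simp only [enorm_mul]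
  have hm : AEMeasurable (fun z : StepTwoGroup B × StepTwoGroup B =>
      ‖F z.2‖ₑ * ‖G (z.2⁻¹ * z.1)‖ₑ ^ 2) (volume.prod volume) :=
    hF.1.comp_snd.enorm.mul (hGm.prod_swap.enorm.pow_const 2)
  have hG2' := (memLp_two_iff_lintegral hG.1).1 hG2
  calc ∫⁻ g, ‖conv F G g‖ₑ ^ 2
      ≤ ∫⁻ g, (∫⁻ h, ‖F h‖ₑ) * ∫⁻ h, ‖F h‖ₑ * ‖G (h⁻¹ * g)‖ₑ ^ 2 := lintegral_mono_ae hpt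
    _ = (∫⁻ h, ‖F h‖ₑ) * ∫⁻ g, ∫⁻ h, ‖F h‖ₑ * ‖G (h⁻¹ * g)‖ₑ ^ 2 :=
        lintegral_const_mul' _ _ hF.2.ne
    _ = (∫⁻ h, ‖F h‖ₑ) * ∫⁻ h, ∫⁻ g, ‖F h‖ₑ * ‖G (h⁻¹ * g)‖ₑ ^ 2 := by
        rw [lintegral_lintegral_swap hm]
    _ = (∫⁻ h, ‖F h‖ₑ) * ∫⁻ h, ‖F h‖ₑ * ∫⁻ g, ‖G g‖ₑ ^ 2 := by
        congr 1
        refine lintegral_congr fun h => ?_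
        rw [lintegral_const_mul' _ _ enorm_ne_top,
          lintegral_mul_left_eq_self (fun g => ‖G g‖ₑ ^ 2)]
    _ < ⊤ := by
        rw [lintegral_mul_const' _ _ hG2'.ne]
        exact ENNReal.mul_lt_top hF.2 (ENNReal.mul_lt_top hF.2 hG2')

/-! ### The partial Fourier transform -/

/-- The partial Fourier transform in terms of Mathlib's normalization `e^{-2πi⟨s, τ⟩}`. -/
theorem partialFourier_eq_fourier (F : StepTwoGroup B → ℂ) (τ : EuclideanSpace ℝ (Fin r))
    (y : EuclideanSpace ℝ (Fin (2 * n))) :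
    partialFourier F τ y
      = FourierTransform.fourier (fun s => F (mk y s)) ((2 * Real.pi)⁻¹ • τ) := by
  rw [Real.fourier_eq', partialFourier]
  refine integral_congr_ae (ae_of_all _ fun s => ?_)
  simp only [smul_eq_mul]
  congr 2
  rw [real_inner_smul_right, real_inner_comm]
  have : (Real.pi : ℂ) ≠ 0 := by exact_mod_cast Real.pi_pos.ne'
  push_cast
  field_simp

theorem integrable_exp_mul {F : StepTwoGroup B → ℂ} (hF : Integrable F)
    (τ : EuclideanSpace ℝ (Fin r)) :
    Integrable fun g : StepTwoGroup B =>
      Complex.exp (-(Complex.I * ((inner ℝ τ g.2 : ℝ) : ℂ))) * F g := by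
  refine hF.bdd_mul (c := 1) ?_ (ae_of_all _ fun g => ?_)
  · have : Continuous fun s : EuclideanSpace ℝ (Fin r) =>
      Complex.exp (-(Complex.I * ((inner ℝ τ s : ℝ) : ℂ))) := by fun_prop
    exact (this.measurable.comp measurable_snd).aestronglyMeasurable
  · rw [← mul_neg, ← Complex.ofReal_neg, mul_comm, Complex.norm_exp_ofReal_mul_I]

theorem integrable_partialFourier {F : StepTwoGroup B → ℂ} (hF : Integrable F)
    (τ : EuclideanSpace ℝ (Fin r)) : Integrable (partialFourier F τ) :=
  Integrable.integral_prod_left (μ := volume) (ν := volume)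
    (f := fun g : EuclideanSpace ℝ (Fin (2 * n)) × EuclideanSpace ℝ (Fin r) =>
      Complex.exp (-(Complex.I * ((inner ℝ τ g.2 : ℝ) : ℂ))) * F g) (integrable_exp_mul hF τ)

theorem integral_partialFourier_mul {F : StepTwoGroup B → ℂ} (hF : Integrable F)
    (τ : EuclideanSpace ℝ (Fin r)) {φ : EuclideanSpace ℝ (Fin (2 * n)) → ℂ} (hφ : Measurable φ)
    {C : ℝ} (hC : ∀ y, ‖φ y‖ ≤ C) :
    ∫ y, partialFourier F τ y * φ y = ∫ g : StepTwoGroup B,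
      F g * (Complex.exp (-(Complex.I * ((inner ℝ τ g.2 : ℝ) : ℂ))) * φ g.1) := by
  have h1 : Integrable fun g : StepTwoGroup B =>
      Complex.exp (-(Complex.I * ((inner ℝ τ g.2 : ℝ) : ℂ))) * F g * φ g.1 :=
    (integrable_exp_mul hF τ).mul_bdd (c := C) (hφ.comp measurable_fst).aestronglyMeasurable
      (ae_of_all _ fun g => hC _)
  have h2 := integral_prod (μ := volume) (ν := volume)
    (fun g : EuclideanSpace ℝ (Fin (2 * n)) × EuclideanSpace ℝ (Fin r) =>
      Complex.exp (-(Complex.I * ((inner ℝ τ g.2 : ℝ) : ℂ))) * F g * φ g.1) h1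
  simp only [integral_mul_const] at h2
  refine Eq.trans h2.symm (integral_congr_ae (ae_of_all _ fun g => ?_))
  simp only []
  ring

/-- By Plancherel in the central variable and Tonelli, almost every `F̃_τ` is square integrable. -/
theorem ae_lintegral_fourier_sq_lt_top {F : StepTwoGroup B → ℂ} (hF : Integrable F) (hF2 : MemLp F 2) :
    ∀ᵐ τ : EuclideanSpace ℝ (Fin r),
      ∫⁻ y, ‖FourierTransform.fourier (fun s => F (mk y s)) τ‖ₑ ^ 2 < ⊤ := by
  have hF' : Integrable (fun z : EuclideanSpace ℝ (Fin (2 * n)) × EuclideanSpace ℝ (Fin r) =>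
    F (mk z.1 z.2)) (volume.prod volume) := hF
  have hF2' : MemLp (fun z : EuclideanSpace ℝ (Fin (2 * n)) × EuclideanSpace ℝ (Fin r) =>
    F (mk z.1 z.2)) 2 (volume.prod volume) := hF2
  have hsq := (memLp_two_iff_lintegral hF'.1).1 hF2'
  have hmeas : AEMeasurable (fun z : EuclideanSpace ℝ (Fin r) × EuclideanSpace ℝ (Fin (2 * n)) =>
      ‖FourierTransform.fourier (fun s => F (mk z.2 s)) z.1‖ₑ ^ 2) (volume.prod volume) := by
    refine AEMeasurable.pow_const (AEStronglyMeasurable.enorm ?_) 2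
    simp only [Real.fourier_eq']
    refine AEStronglyMeasurable.integral_prod_right'
      (f := fun w : (EuclideanSpace ℝ (Fin r) × EuclideanSpace ℝ (Fin (2 * n)))
        × EuclideanSpace ℝ (Fin r) =>
        Complex.exp (((-2 * Real.pi * inner ℝ w.2 w.1.1 : ℝ) : ℂ) * Complex.I) •
          F (mk w.1.2 w.2)) ?_
    have hexp : Continuous
        fun w : (EuclideanSpace ℝ (Fin r) × EuclideanSpace ℝ (Fin (2 * n)))
          × EuclideanSpace ℝ (Fin r) =>
        Complex.exp (((-2 * Real.pi * inner ℝ w.2 w.1.1 : ℝ) : ℂ) * Complex.I) := by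
      fun_prop
    refine hexp.aestronglyMeasurable.smul ?_
    have hq : Measure.QuasiMeasurePreserving
        (fun w : (EuclideanSpace ℝ (Fin r) × EuclideanSpace ℝ (Fin (2 * n)))
          × EuclideanSpace ℝ (Fin r) => (w.1.2, w.2))
        ((volume.prod volume).prod volume) (volume.prod volume) :=
      Measure.quasiMeasurePreserving_snd.comp
        (measurePreserving_prodAssoc volume volume volume).quasiMeasurePreserving
    exact hF'.1.comp_quasiMeasurePreserving hq
  have hpl : ∀ᵐ y : EuclideanSpace ℝ (Fin (2 * n)),
      ∫⁻ τ, ‖FourierTransform.fourier (fun s => F (mk y s)) τ‖ₑ ^ 2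
        = ∫⁻ s, ‖F (mk y s)‖ₑ ^ 2 := by
    have hi := (memLp_two_iff_integrable_sq_norm hF'.1).1 hF2'
    filter_upwards [hF'.prod_right_ae, hi.prod_right_ae] with y h1 h2
    have h3 : MemLp (fun s => F (mk y s)) 2 := (memLp_two_iff_integrable_sq_norm h1.1).2 h2
    rw [← eLpNorm_two_sq, ← eLpNorm_two_sq]
    rw [eLpNorm_fourier_eq h1 h3]
  refine ae_lt_top' hmeas.lintegral_prod_right' ?_
  rw [lintegral_lintegral_swap hmeas, lintegral_congr_ae hpl,
    ← lintegral_prod (fun z => ‖F (mk z.1 z.2)‖ₑ ^ 2) (hF'.1.enorm.pow_const 2)]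
  exact hsq.ne

theorem ae_memLp_two_partialFourier {F : StepTwoGroup B → ℂ} (hF : Integrable F)
    (hF2 : MemLp F 2) : ∀ᵐ τ : EuclideanSpace ℝ (Fin r), MemLp (partialFourier F τ) 2 := by
  have hc : (2 * Real.pi)⁻¹ ≠ 0 := by have := Real.pi_pos; positivity
  have hq : Measure.QuasiMeasurePreserving
      (fun τ : EuclideanSpace ℝ (Fin r) => (2 * Real.pi)⁻¹ • τ) volume volume :=
    ⟨by fun_prop, by
      rw [Measure.map_addHaar_smul _ hc]
      exact Measure.smul_absolutelyContinuous⟩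
  filter_upwards [hq.ae (ae_lintegral_fourier_sq_lt_top hF hF2)] with τ hτ
  rw [memLp_two_iff_lintegral (integrable_partialFourier hF τ).1]
  simpa only [partialFourier_eq_fourier] using hτ

end StepTwoGroup

/-! ### The product formula -/

namespace NormalizingBasis

variable {n r : ℕ} {B : SkewMap n r} {τ : EuclideanSpace ℝ (Fin r)} (e : NormalizingBasis B τ)

/-- Multi-indices of positive integers and of natural numbers, matched by subtracting `1`. -/
def multiIndexEquiv (n : ℕ) : (Fin n → ℕ+) ≃ (Fin n → ℕ) :=
  Equiv.piCongrRight fun _ => Equiv.pnatEquivNat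

theorem multiIndexEquiv_apply (q : Fin n → ℕ+) (j : Fin n) :
    multiIndexEquiv n q j = (q j).natPred := rfl

theorem scaledCoord_add (x y : EuclideanSpace ℝ (Fin (2 * n))) (j : Fin n) :
    e.scaledCoord (x + y) j = e.scaledCoord x j + e.scaledCoord y j := by
  simp only [scaledCoord, coord_add, mul_add]

theorem tauForm_eq_sum_scaledCoord (x y : EuclideanSpace ℝ (Fin (2 * n))) :
    2 * B.tauForm τ x y = -∑ j, (conj (e.scaledCoord x j) * e.scaledCoord y j).im := by
  rw [e.tauForm_eq_sum_coord, mul_neg, Finset.mul_sum]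
  congr 1
  refine Finset.sum_congr rfl fun j _ => ?_
  have h : ((√(2 * e.mu j) : ℝ) : ℂ) * (√(2 * e.mu j) : ℝ) = ((2 * e.mu j : ℝ) : ℂ) := by
    rw [← Complex.ofReal_mul, Real.mul_self_sqrt (by linarith [e.mu_nonneg j])]
  have : conj (e.scaledCoord x j) * e.scaledCoord y j
      = ((2 * e.mu j : ℝ) : ℂ) * (conj (e.coord x j) * e.coord y j) := by
    rw [← h, scaledCoord, scaledCoord, map_mul, Complex.conj_ofReal]; ring
  rw [this, Complex.im_ofReal_mul]
  ring

/-- The addition theorem for the Laguerre basis, with the cocycle of the group law as phase. -/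
theorem hasSum_basisFun_mul (hμ : ∀ j, 0 < e.mu j) (p m : Fin n → ℕ+)
    (x y : EuclideanSpace ℝ (Fin (2 * n))) :
    HasSum (fun q => e.basisFun p q x * e.basisFun q m y)
      (e.density * (Complex.exp (Complex.I * ((2 * B.tauForm τ x y : ℝ) : ℂ))
        * e.basisFun p m (x + y))) := by
  have h := ((hasSum_pi_prod (fun j => hasSum_dispCoeff_mul (e.scaledCoord x j)
    (e.scaledCoord y j) (p j).natPred (m j).natPred)
    (fun j => summable_norm_dispCoeff_mul _ _ _ _)).1.mul_left ((e.density : ℂ) ^ 2))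
  rw [← (multiIndexEquiv n).hasSum_iff] at h
  convert! h using 1
  · ext q
    simp only [Function.comp_apply, multiIndexEquiv_apply, e.basisFun_eq hμ,
      Finset.prod_mul_distrib]
    ring
  · rw [e.basisFun_eq hμ, e.tauForm_eq_sum_scaledCoord, Finset.prod_mul_distrib, ← Complex.exp_sum]
    simp only [scaledCoord_add]
    push_cast
    rw [mul_neg, Finset.mul_sum, ← Finset.sum_neg_distrib]
    ring

theorem hasSum_norm_basisFun_sq (hμ : ∀ j, 0 < e.mu j) (p : Fin n → ℕ+)
    (x : EuclideanSpace ℝ (Fin (2 * n))) :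
    HasSum (fun q => ‖e.basisFun p q x‖ ^ 2) (e.density ^ 2) := by
  have h := ((hasSum_pi_prod (fun j => hasSum_norm_dispCoeff_sq (p j).natPred (e.scaledCoord x j))
    (fun j => (hasSum_norm_dispCoeff_sq _ _).summable.norm)).1.mul_left (e.density ^ 2))
  rw [← (multiIndexEquiv n).hasSum_iff] at h
  convert! h using 1
  · ext q
    simp only [Function.comp_apply, multiIndexEquiv_apply, e.basisFun_eq hμ, norm_mul, norm_prod,
      Complex.norm_real, mul_pow, Real.norm_eq_abs, sq_abs, Finset.prod_pow]
  · simp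

theorem hasSum_norm_basisFun_sq' (hμ : ∀ j, 0 < e.mu j) (m : Fin n → ℕ+)
    (x : EuclideanSpace ℝ (Fin (2 * n))) :
    HasSum (fun q => ‖e.basisFun q m x‖ ^ 2) (e.density ^ 2) := by
  have h := ((hasSum_pi_prod (fun j => hasSum_norm_dispCoeff_sq' (m j).natPred (e.scaledCoord x j))
    (fun j => (hasSum_norm_dispCoeff_sq' _ _).summable.norm)).1.mul_left (e.density ^ 2))
  rw [← (multiIndexEquiv n).hasSum_iff] at h
  convert! h using 1
  · ext q
    simp only [Function.comp_apply, multiIndexEquiv_apply, e.basisFun_eq hμ, norm_mul, norm_prod,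
      Complex.norm_real, mul_pow, Real.norm_eq_abs, sq_abs, Finset.prod_pow]
  · simp

/-- The function `e^{-iτ·t} conj(ℓ_{p,k}(x))` of `g = (x, t)`, against which the coefficients of a
function on the group are integrated (`laguerreTensor_eq`). -/
def groupCoeff (p k : Fin n → ℕ+) (g : StepTwoGroup B) : ℂ :=
  Complex.exp (-(Complex.I * ((inner ℝ τ g.2 : ℝ) : ℂ))) * conj (e.basisFun p k g.1)

theorem measurable_groupCoeff (hμ : ∀ j, 0 < e.mu j) (p k : Fin n → ℕ+) :
    Measurable (e.groupCoeff p k) := by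
  have h1 : Continuous fun s : EuclideanSpace ℝ (Fin r) =>
      Complex.exp (-(Complex.I * ((inner ℝ τ s : ℝ) : ℂ))) := by fun_prop
  have h2 : Continuous fun y => conj (e.basisFun p k y) :=
    Complex.continuous_conj.comp (e.continuous_basisFun hμ p k)
  exact (h1.measurable.comp StepTwoGroup.measurable_snd).mul
    (h2.measurable.comp StepTwoGroup.measurable_fst)

theorem norm_groupCoeff (p k : Fin n → ℕ+) (g : StepTwoGroup B) :
    ‖e.groupCoeff p k g‖ = ‖e.basisFun p k g.1‖ := by
  rw [groupCoeff, norm_mul, RCLike.norm_conj, ← mul_neg, ← Complex.ofReal_neg, mul_comm Complex.I,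
    Complex.norm_exp_ofReal_mul_I, one_mul]

/-- Up to the factor `density`, `g ↦ groupCoeff · · g` is a matrix representation of the group. -/
theorem hasSum_groupCoeff_mul (hμ : ∀ j, 0 < e.mu j) (p m : Fin n → ℕ+) (g h : StepTwoGroup B) :
    HasSum (fun q => e.groupCoeff p q g * e.groupCoeff q m h)
      (e.density * e.groupCoeff p m (g * h)) := by
  have hs := (Complex.hasSum_conj'.2 (e.hasSum_basisFun_mul hμ p m g.1 h.1)).mul_left
    (Complex.exp (-(Complex.I * ((inner ℝ τ g.2 : ℝ) : ℂ)))
      * Complex.exp (-(Complex.I * ((inner ℝ τ h.2 : ℝ) : ℂ))))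
  convert! hs using 1
  · ext q
    simp only [groupCoeff, map_mul]
    ring
  · rw [groupCoeff, StepTwoGroup.mul_snd, StepTwoGroup.mul_fst, inner_add_right, inner_add_right,
      real_inner_smul_right, B.inner_map, map_mul, map_mul, ← Complex.exp_conj, map_mul,
      Complex.conj_ofReal, Complex.conj_ofReal, Complex.conj_I]
    have : Complex.exp (-(Complex.I * ((inner ℝ τ g.2 + inner ℝ τ h.2
          + 2 * B.tauForm τ g.1 h.1 : ℝ) : ℂ)))
        = Complex.exp (-(Complex.I * ((inner ℝ τ g.2 : ℝ) : ℂ)))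
          * Complex.exp (-(Complex.I * ((inner ℝ τ h.2 : ℝ) : ℂ)))
          * Complex.exp (-Complex.I * ((2 * B.tauForm τ g.1 h.1 : ℝ) : ℂ)) := by
      rw [← Complex.exp_add, ← Complex.exp_add]
      congr 1
      push_cast
      ring
    rw [this]
    ring

theorem laguerreTensor_eq (hμ : ∀ j, 0 < e.mu j) {F : StepTwoGroup B → ℂ} (hF : Integrable F)
    (p k : Fin n → ℕ+) :
    e.laguerreTensor F p k = (∫ g, F g * e.groupCoeff p k g) / (e.density : ℂ) := by
  rw [laguerreTensor, e.coeff_eq hμ, StepTwoGroup.integral_partialFourier_mul hF τ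
    (φ := fun y => conj (e.basisFun p k y))
    (Complex.continuous_conj.comp (e.continuous_basisFun hμ p k)).measurable
    (fun y => by rw [RCLike.norm_conj]; exact e.norm_basisFun_le hμ p k y)]
  rfl

/-- The tensor of a convolution is the matrix product of the tensors. By left invariance,
`∫ (F * G) χ = ∬ F(g) G(h) χ(gh)`; the matrix entries of `gh` are expanded and the sum is
interchanged with the integral. -/
theorem hasSum_laguerreTensor_mul (hμ : ∀ j, 0 < e.mu j) {F G : StepTwoGroup B → ℂ}
    (hF : Integrable F) (hG : Integrable G) (p m : Fin n → ℕ+) :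
    HasSum (fun q => e.laguerreTensor F p q * e.laguerreTensor G q m)
      (e.laguerreTensor (StepTwoGroup.conv F G) p m) := by
  have hd : (e.density : ℂ) ≠ 0 := by exact_mod_cast (e.density_pos hμ).ne'
  have hbd : ∀ p k (g : StepTwoGroup B), ‖e.groupCoeff p k g‖ ≤ e.density := fun p k g => by
    rw [norm_groupCoeff]; exact e.norm_basisFun_le hμ p k _
  have hFG : Integrable (fun z : StepTwoGroup B × StepTwoGroup B => F z.1 * G z.2)
    (volume.prod volume) := hF.mul_prod hG
  have hmeas : ∀ q, Measurable fun z : StepTwoGroup B × StepTwoGroup B =>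
      e.groupCoeff p q z.1 * e.groupCoeff q m z.2 := fun q =>
    ((e.measurable_groupCoeff hμ p q).comp measurable_fst).mul
      ((e.measurable_groupCoeff hμ q m).comp measurable_snd)
  -- The terms are dominated by means of `2ab ≤ a² + b²`, as the rows and the columns of the
  -- representation matrices are square summable, with constant sum `density ^ 2`.
  have hb : ∀ z : StepTwoGroup B × StepTwoGroup B, HasSum (fun q => ‖F z.1 * G z.2‖
      * ((‖e.basisFun p q z.1.1‖ ^ 2 + ‖e.basisFun q m z.2.1‖ ^ 2) / 2))
      (‖F z.1 * G z.2‖ * ((e.density ^ 2 + e.density ^ 2) / 2)) := fun z =>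
    (((e.hasSum_norm_basisFun_sq hμ p z.1.1).add
      (e.hasSum_norm_basisFun_sq' hμ m z.2.1)).div_const 2).mul_left _
  have hsum := hasSum_integral_of_dominated_convergence
    (μ := (volume : Measure (StepTwoGroup B)).prod volume)
    (F := fun q z => F z.1 * G z.2 * (e.groupCoeff p q z.1 * e.groupCoeff q m z.2))
    (f := fun z => F z.1 * G z.2 * (e.density * e.groupCoeff p m (z.1 * z.2)))
    (fun q z => ‖F z.1 * G z.2‖
      * ((‖e.basisFun p q z.1.1‖ ^ 2 + ‖e.basisFun q m z.2.1‖ ^ 2) / 2))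
    (fun q => hFG.1.mul (hmeas q).aestronglyMeasurable)
    (fun q => ae_of_all _ fun z => by
      rw [norm_mul, norm_mul (e.groupCoeff p q z.1), norm_groupCoeff, norm_groupCoeff]
      refine mul_le_mul_of_nonneg_left ?_ (norm_nonneg _)
      have := two_mul_le_add_sq ‖e.basisFun p q z.1.1‖ ‖e.basisFun q m z.2.1‖
      linarith)
    (ae_of_all _ fun z => (hb z).summable)
    (by
      simp_rw [fun z => (hb z).tsum_eq]
      exact hFG.norm.mul_const _)
    (ae_of_all _ fun z => (e.hasSum_groupCoeff_mul hμ p m z.1 z.2).mul_left _)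
  have hterm : ∀ q, ∫ z : StepTwoGroup B × StepTwoGroup B,
      F z.1 * G z.2 * (e.groupCoeff p q z.1 * e.groupCoeff q m z.2) ∂(volume.prod volume)
      = (∫ g, F g * e.groupCoeff p q g) * ∫ g, G g * e.groupCoeff q m g := fun q => by
    rw [← integral_prod_mul]
    refine integral_congr_ae (ae_of_all _ fun z => ?_)
    simp only []
    ring
  have hlim : ∫ z : StepTwoGroup B × StepTwoGroup B,
      F z.1 * G z.2 * (e.density * e.groupCoeff p m (z.1 * z.2)) ∂(volume.prod volume)
      = e.density * ∫ g, StepTwoGroup.conv F G g * e.groupCoeff p m g := by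
    rw [StepTwoGroup.integral_conv_mul hF hG (e.measurable_groupCoeff hμ p m) (hbd p m)]
    have hint : Integrable (fun z : StepTwoGroup B × StepTwoGroup B =>
        F z.1 * G z.2 * (e.density * e.groupCoeff p m (z.1 * z.2))) (volume.prod volume) := by
      refine hFG.mul_bdd (c := e.density * e.density) (Measurable.aestronglyMeasurable
        (measurable_const.mul ((e.measurable_groupCoeff hμ p m).comp measurable_mul)))
        (ae_of_all _ fun z => ?_)
      rw [norm_mul, Complex.norm_real, Real.norm_of_nonneg (e.density_pos hμ).le]
      exact mul_le_mul_of_nonneg_left (hbd _ _ _) (e.density_pos hμ).le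
    rw [integral_prod _ hint, ← integral_const_mul]
    refine integral_congr_ae (ae_of_all _ fun h => ?_)
    simp only []
    rw [← integral_const_mul]
    refine integral_congr_ae (ae_of_all _ fun k => ?_)
    simp only []
    ring
  simp_rw [hterm] at hsum
  rw [hlim] at hsum
  have hfin := hsum.div_const ((e.density : ℂ) ^ 2)
  convert! hfin using 1
  · ext q
    rw [e.laguerreTensor_eq hμ hF, e.laguerreTensor_eq hμ hG]
    field_simp
  · rw [e.laguerreTensor_eq hμ (StepTwoGroup.integrable_conv hF hG)]
    field_simp

end NormalizingBasis

end

theorem theorem1p1 (n r : ℕ) (B : SkewMap n r)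
    (hB : ∀ᵐ τ : EuclideanSpace ℝ (Fin r), B.TauNondegenerate τ)
    (F G : StepTwoGroup B → ℂ)
    (hF1 : MemLp F 1) (hF2 : MemLp F 2) (hG1 : MemLp G 1) (hG2 : MemLp G 2) :
    ∀ᵐ τ : EuclideanSpace ℝ (Fin r),
      Nonempty (NormalizingBasis B τ) ∧
      ∀ e : NormalizingBasis B τ,
        e.HasExpansion (StepTwoGroup.partialFourier F τ) (e.laguerreTensor F) ∧
        e.HasExpansion (StepTwoGroup.partialFourier G τ) (e.laguerreTensor G) ∧
        e.HasExpansion (StepTwoGroup.partialFourier (StepTwoGroup.conv F G) τ)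
          (e.laguerreTensor (StepTwoGroup.conv F G)) ∧
        ∀ p m : Fin n → ℕ+,
          HasSum (fun q : Fin n → ℕ+ => e.laguerreTensor F p q * e.laguerreTensor G q m)
            (e.laguerreTensor (StepTwoGroup.conv F G) p m) := by
  rw [memLp_one_iff_integrable] at hF1 hG1
  filter_upwards [hB, StepTwoGroup.ae_memLp_two_partialFourier hF1 hF2,
    StepTwoGroup.ae_memLp_two_partialFourier hG1 hG2,
    StepTwoGroup.ae_memLp_two_partialFourier (StepTwoGroup.integrable_conv hF1 hG1)
      (StepTwoGroup.memLp_two_conv hF1 hG1 hG2)] with τ hτ hF hG hFG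
  refine ⟨B.nonempty_normalizingBasis τ hτ, fun e => ?_⟩
  have hμ := e.mu_pos hτ
  exact ⟨e.hasExpansion_coeff hμ hF, e.hasExpansion_coeff hμ hG, e.hasExpansion_coeff hμ hFG,
    e.hasSum_laguerreTensor_mul hμ hF1 hG1⟩
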